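/- Fix integers $d\ge 1$, $T\ge 0$ and a real number $\lambda$. A randomized adaptive $T$-query algorithm draws a random seed $\xi$ and then, in rounds $i=1,\dots,T$, queries a vector $v^{(i)}\in\mathbb{R}^d$ that is a measurable function of $\xi$ and of the previous pairs $(v^{(1)},w^{(1)}),\dots,(v^{(i-1)},w^{(i-1)})$, and receives the exact response $w^{(i)}=Mv^{(i)}$, where $M$ is a symmetric $d\times d$ matrix. Its transcript is $Z_T=\big((v^{(1)},w^{(1)}),\dots,(v^{(T)},w^{(T)})\big)$. Let $W\sim\mathrm{GOE}(d)$ be the random symmetric matrix with independent entries $W_{ij}$, $i\le j$, where $W_{ij}\sim\mathcal N(0,1)$ for $i<j$ and $W_{ii}\sim\mathcal N(0,2)$. For $\theta\in\{0\}\cup\mathcal S^{d-1}$, where $\mathcal S^{d-1}$ is the Euclidean unit sphere in $\mathbb{R}^d$, let $\mathbf P_\theta$ be the law of $Z_T$ when the algorithm is run on $M=\lambda\theta\theta^\top+\frac1{\sqrt d}W$ with $W$ independent of the seed. Thus $\mathbf P_0$ is the law of the transcript under the null model $M=\frac1{\sqrt d}W$. Let $\overline{\mathbf P}=\mathbb E_{\theta\sim\mathcal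 P}\mathbf P_\theta$ be the mixture over the uniform distribution $\mathcal P$ on $\mathcal S^{d-1}$, and write $\|\mathbf P-\mathbf Q\|_{\mathrm{TV}}=\sup_B|\mathbf P(B)-\mathbf Q(B)|$, the supremum over measurable sets $B$. **Proposition.** There is an absolute constant $c_1>1$ such that for all $d\ge1$, $T\ge 0$, all $\lambda>2$ and every randomized adaptive $T$-query algorithm, $$\|\mathbf P_0-\overline{\mathbf P}\|_{\mathrm{TV}}\;\le\;\frac{\sqrt2\,(c_1\lambda)^T}{d^{1/4}}\left(\sqrt{\log\frac{d}{(c_1\lambda)^T}}+4\right),$$ where the square root is read as $0$ if $(c_1\lambda)^T>d$ (its argument is then negative and the bound is trivial, the right-hand side being larger than $1$). -/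

import Mathlib

open MeasureTheory ProbabilityTheory

noncomputable section

namespace SpikedQuery

/-- `ℝ^d` with its Euclidean norm. -/
abbrev Vec (d : ℕ) : Type := EuclideanSpace ℝ (Fin d)

/-- Matrix-vector product on `ℝ^d`. -/
def mulV {d : ℕ} (M : Matrix (Fin d) (Fin d) ℝ) (v : Vec d) : Vec d :=
  WithLp.toLp 2 (M.mulVec v.ofLp)

/-! ### Adaptive randomized query algorithms -/

/-- An adaptive randomized algorithm making `T` queries to a `d × d` matrix, with random seed in
`Ξ`. The query of round `i` (rounds are numbered `0, …, T - 1`) is an arbitrary vector, a measurable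
function of the seed and of the `i` query-response pairs seen before. A deterministic algorithm is
the case of a one-point `Ξ`. -/
structure QueryAlgorithm (d T : ℕ) (Ξ : Type*) [MeasurableSpace Ξ] where
  query : (i : Fin T) → Ξ → (Fin i → Vec d × Vec d) → Vec d
  measurable_query : ∀ i, Measurable (Function.uncurry (query i))

namespace QueryAlgorithm

variable {d T : ℕ} {Ξ : Type*} [MeasurableSpace Ξ]

/-- The first `k ≤ T` query-response pairs `(v, M v)` when the algorithm runs on the matrix `M`
with seed `ξ`. -/
def transcriptUpTo (A : QueryAlgorithm d T Ξ) (M : Matrix (Fin d) (Fin d) ℝ) (ξ : Ξ) :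
    (k : ℕ) → k ≤ T → Fin k → Vec d × Vec d
  | 0, _ => Fin.elim0
  | k + 1, hk =>
    let Z : Fin k → Vec d × Vec d := A.transcriptUpTo M ξ k (Nat.le_of_succ_le hk)
    let v : Vec d := A.query ⟨k, hk⟩ ξ Z
    Fin.snoc (α := fun _ => Vec d × Vec d) Z (v, mulV M v)

/-- The full transcript `Z_T` of all `T` query-response pairs. -/
def transcript (A : QueryAlgorithm d T Ξ) (M : Matrix (Fin d) (Fin d) ℝ) (ξ : Ξ) :
    Fin T → Vec d × Vec d :=
  A.transcriptUpTo M ξ T le_rfl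

end QueryAlgorithm

/-! ### The Gaussian orthogonal ensemble and the deformed Wigner model -/

/-- Index pairs on or above the diagonal. -/
abbrev UpperIdx (d : ℕ) : Type := {p : Fin d × Fin d // p.1 ≤ p.2}

/-- The joint law of the entries `W i j`, `i ≤ j`, of a `GOE(d)` matrix: independent, centred
Gaussian, of variance `2` on the diagonal and `1` above it. -/
def goeEntries (d : ℕ) : Measure (UpperIdx d → ℝ) :=
  Measure.pi fun p => gaussianReal 0 (if p.1.1 = p.1.2 then 2 else 1)

/-- The symmetric matrix with the given entries on and above the diagonal. -/
def symmMatrix {d : ℕ} (g : UpperIdx d → ℝ) : Matrix (Fin d) (Fin d) ℝ :=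
  Matrix.of fun i j => g ⟨(min i j, max i j), min_le_max⟩

/-- `M = lam θ θᵀ + W / √d`, where `W` is the symmetric matrix with upper entries `g`. -/
def spikedMatrix {d : ℕ} (lam : ℝ) (θ : Vec d) (g : UpperIdx d → ℝ) :
    Matrix (Fin d) (Fin d) ℝ :=
  lam • Matrix.vecMulVec θ.ofLp θ.ofLp + (1 / Real.sqrt d) • symmMatrix g

/-- The uniform probability measure on the unit sphere of `ℝ^d` (normalized surface measure), as a
measure on `ℝ^d`. -/
def uniformSphere (d : ℕ) : Measure (Vec d) :=
  (((volume : Measure (Vec d)).toSphere Set.univ)⁻¹ • (volume : Measure (Vec d)).toSphere).map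
    (fun x : Metric.sphere (0 : Vec d) 1 => (x : Vec d))

variable {d T : ℕ} {Ξ : Type*} [MeasurableSpace Ξ]

/-- `P_θ`: the law of the transcript when the algorithm, with seed drawn from `ρ`, is run on
`M = lam θ θᵀ + W / √d` with `W ∼ GOE(d)` independent of the seed. The null law is `P_0`
(that is, `θ = 0`, so that `M = W / √d`). -/
def transcriptLaw (A : QueryAlgorithm d T Ξ) (ρ : Measure Ξ) (lam : ℝ) (θ : Vec d) :
    Measure (Fin T → Vec d × Vec d) :=
  ((goeEntries d).prod ρ).map fun p => A.transcript (spikedMatrix lam θ p.1) p.2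

/-- The mixture of the laws `P_θ` over `θ` uniform on the unit sphere. -/
def mixtureLaw (A : QueryAlgorithm d T Ξ) (ρ : Measure Ξ) (lam : ℝ) :
    Measure (Fin T → Vec d × Vec d) :=
  (uniformSphere d).bind (transcriptLaw A ρ lam)

/-- Total variation distance `sup_B |μ(B) - ν(B)|`, the supremum over measurable sets, for
probability measures `μ`, `ν`. -/
def tvDist {X : Type*} [MeasurableSpace X] (μ ν : Measure X) : ℝ :=
  ⨆ B : {B : Set X // MeasurableSet B}, |μ.real B.1 - ν.real B.1|

/-! ### The laws above are genuine probability measures -/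

lemma measurable_transcriptUpTo (A : QueryAlgorithm d T Ξ) (lam : ℝ) (k : ℕ) (hk : k ≤ T) :
    Measurable fun p : Vec d × ((UpperIdx d → ℝ) × Ξ) =>
      A.transcriptUpTo (spikedMatrix lam p.1 p.2.1) p.2.2 k hk := by
  induction k with
  | zero =>
    have : (fun p : Vec d × ((UpperIdx d → ℝ) × Ξ) =>
        A.transcriptUpTo (spikedMatrix lam p.1 p.2.1) p.2.2 0 hk) = fun _ => Fin.elim0 := rfl
    rw [this]
    exact measurable_const
  | succ k ih =>
    have hZ := ih (Nat.le_of_succ_le hk)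
    have hv := (A.measurable_query ⟨k, hk⟩).comp (measurable_snd.snd.prodMk hZ)
    have hw : Measurable fun p : Vec d × ((UpperIdx d → ℝ) × Ξ) =>
        mulV (spikedMatrix lam p.1 p.2.1) (A.query ⟨k, hk⟩ p.2.2
          (A.transcriptUpTo (spikedMatrix lam p.1 p.2.1) p.2.2 k (Nat.le_of_succ_le hk))) := by
      refine (WithLp.measurable_toLp 2 _).comp (measurable_pi_lambda _ fun i => ?_)
      simp only [Matrix.mulVec, dotProduct]
      refine Finset.measurable_sum _ fun j _ => Measurable.mul ?_ ?_
      · simp only [spikedMatrix, symmMatrix, Matrix.add_apply, Matrix.smul_apply,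
          Matrix.vecMulVec_apply, Matrix.of_apply, smul_eq_mul]
        fun_prop
      · exact (measurable_pi_apply j).comp ((WithLp.measurable_ofLp 2 _).comp hv)
    refine measurable_pi_lambda _ fun i => ?_
    refine Fin.lastCases ?_ (fun j => ?_) i
    · simpa [QueryAlgorithm.transcriptUpTo] using hv.prodMk hw
    · simpa [QueryAlgorithm.transcriptUpTo, Function.comp_def] using (measurable_pi_apply j).comp hZ

lemma measurable_transcript (A : QueryAlgorithm d T Ξ) (lam : ℝ) :
    Measurable fun p : Vec d × ((UpperIdx d → ℝ) × Ξ) =>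
      A.transcript (spikedMatrix lam p.1 p.2.1) p.2.2 :=
  measurable_transcriptUpTo A lam T le_rfl

instance (d : ℕ) : IsProbabilityMeasure (goeEntries d) := by
  unfold goeEntries; infer_instance

instance (A : QueryAlgorithm d T Ξ) (ρ : Measure Ξ) [IsProbabilityMeasure ρ] (lam : ℝ)
    (θ : Vec d) : IsProbabilityMeasure (transcriptLaw A ρ lam θ) :=
  Measure.isProbabilityMeasure_map
    ((measurable_transcript A lam).comp measurable_prodMk_left).aemeasurable

lemma measurable_transcriptLaw (A : QueryAlgorithm d T Ξ) (ρ : Measure Ξ) [IsProbabilityMeasure ρ]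
    (lam : ℝ) : Measurable (transcriptLaw A ρ lam) := by
  refine Measure.measurable_of_measurable_coe _ fun s hs => ?_
  have h := measurable_measure_prodMk_left (ν := (goeEntries d).prod ρ)
    (measurable_transcript A lam hs)
  convert h using 2 with θ
  exact Measure.map_apply ((measurable_transcript A lam).comp measurable_prodMk_left) hs

lemma isProbabilityMeasure_uniformSphere (hd : 0 < d) :
    IsProbabilityMeasure (uniformSphere d) := by
  have : Nonempty (Fin d) := ⟨⟨0, hd⟩⟩
  have : NeZero ((volume : Measure (Vec d)).toSphere) := ⟨Measure.toSphere_ne_zero _⟩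
  exact Measure.isProbabilityMeasure_map measurable_subtype_coe.aemeasurable

lemma isProbabilityMeasure_mixtureLaw (hd : 0 < d) (A : QueryAlgorithm d T Ξ) (ρ : Measure Ξ)
    [IsProbabilityMeasure ρ] (lam : ℝ) : IsProbabilityMeasure (mixtureLaw A ρ lam) := by
  have := isProbabilityMeasure_uniformSphere hd
  refine ⟨?_⟩
  rw [mixtureLaw, Measure.bind_apply MeasurableSet.univ
    (measurable_transcriptLaw A ρ lam).aemeasurable]
  simp

end SpikedQuery

end

noncomputable section

namespace SpikedQuery

open Matrix
open scoped ENNReal NNReal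

/-! Put H = √d λθθᵀ. Running on the spiked matrix is running the null model on the noise W + H,
whose density relative to W is exp(tr(HW)/2 − tr(H²)/4) by Cameron–Martin. The transcript reveals W
except for the block QWQ, where Q projects onto the orthogonal complement of the queries. Adaptivity
does no harm: given the transcript, that block may be replaced by the block of an independent copy
(`lintegral_nullTranscript_resample`). Integrating it out leaves an explicit likelihood ratio of
transcripts, `likelihood Q H`.

The product of two such ratios, at spikes θ and θ', is the ratio for the sum of the two shifts, of
integral one, times the exponential of a cross term. The cross term is at most dλ²R|⟨θ,θ'⟩| if both
squared overlaps with the span of the queries are at most R (`IsOrthProj.cross_le`). For independent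
uniform θ, θ' the inner product has size d^(-1/2). Hence the mixture likelihood Y, truncated to
overlaps at most R, has second moment 1 + O(√d λ²R).

The truncation must cost little under the mixture. Under the null model the queries are independent
of θ, so a new query direction has squared overlap above τ with probability at most √2 exp(-dτ/4).
Passing to the spiked law costs a second moment of at most exp(dλ²R) as long as the previous overlap
is at most R. The level can therefore grow by the factor 5λ² in each round, starting from order log
d/(dλ²), with failure probability at most √2/d per round (`exceedMass_overlapLevel_le`).

At the final level the second moment exceeds 1 by O((5λ²)^T log d/√d), which the square of the
claimed bound dominates when that bound is below 1. A quadratic inequality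
(`lintegral_le_of_second_moment`) turns this into P_0(B) ≤ P̄(B) + ε, because Y lies below the
mixture likelihood. Complements give the reverse inequality. -/

/-- The entries of a square matrix on and above the diagonal. -/
def upperPart {d : ℕ} (M : Matrix (Fin d) (Fin d) ℝ) : UpperIdx d → ℝ := fun p => M p.1.1 p.1.2

/-- The variance of an entry of a `GOE` matrix. -/
def entryVar {d : ℕ} (p : UpperIdx d) : ℝ≥0 := if p.1.1 = p.1.2 then 2 else 1

/-! ### Symmetric matrices and the trace form -/

section Symmetric

variable {d : ℕ}

lemma entryVar_ne_zero (p : UpperIdx d) : entryVar p ≠ 0 := by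
  unfold entryVar; split_ifs <;> norm_num

lemma entryVar_pos (p : UpperIdx d) : (0 : ℝ) < entryVar p :=
  NNReal.coe_pos.2 (pos_iff_ne_zero.2 (entryVar_ne_zero p))

lemma goeEntries_eq (d : ℕ) :
    goeEntries d = Measure.pi fun p : UpperIdx d => gaussianReal 0 (entryVar p) := rfl

lemma symmMatrix_apply (g : UpperIdx d → ℝ) (p : UpperIdx d) :
    symmMatrix g p.1.1 p.1.2 = g p := by
  simp only [symmMatrix, Matrix.of_apply]
  congr 1
  ext <;> simp [min_eq_left p.2, max_eq_right p.2]

lemma isSymm_symmMatrix (g : UpperIdx d → ℝ) : (symmMatrix g).IsSymm := by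
  ext i j
  simp only [symmMatrix, Matrix.transpose_apply, Matrix.of_apply]
  congr 1
  ext <;> simp [min_comm, max_comm]

lemma symmMatrix_upperPart {M : Matrix (Fin d) (Fin d) ℝ} (hM : M.IsSymm) :
    symmMatrix (upperPart M) = M := by
  ext i j
  simp only [symmMatrix, upperPart, Matrix.of_apply]
  rcases le_total i j with h | h
  · simp [min_eq_left h, max_eq_right h]
  · simpa [min_eq_right h, max_eq_left h] using hM.apply i j

lemma symmMatrix_add (g h : UpperIdx d → ℝ) :
    symmMatrix (g + h) = symmMatrix g + symmMatrix h := by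
  ext i j; simp [symmMatrix]

/-- An off-diagonal entry is counted twice and a diagonal one once, which is exactly 2 divided by
the `GOE` variance. This is why every Gaussian computation below can be written with traces. -/
lemma sum_sum_eq_sum_upperIdx (f : Fin d → Fin d → ℝ) (hf : ∀ i j, f i j = f j i) :
    ∑ i, ∑ j, f i j = ∑ p : UpperIdx d, 2 / (entryVar p : ℝ) * f p.1.1 p.1.2 := by
  have h1 : ∑ i, ∑ j, f i j = ∑ p : Fin d × Fin d, f p.1 p.2 := by
    rw [← Finset.univ_product_univ, Finset.sum_product]
  have h2 : ∑ p : Fin d × Fin d with ¬ p.1 ≤ p.2, f p.1 p.2 =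
      ∑ p : Fin d × Fin d with p.1 < p.2, f p.1 p.2 := by
    refine Finset.sum_nbij' Prod.swap Prod.swap ?_ ?_ ?_ ?_ ?_ <;> simp
    intro a b _
    exact hf a b
  have h3 : ∑ p : Fin d × Fin d with p.1 < p.2, f p.1 p.2 =
      ∑ p : Fin d × Fin d with p.1 ≤ p.2, if p.1 = p.2 then 0 else f p.1 p.2 := by
    rw [Finset.sum_filter, Finset.sum_filter]
    refine Finset.sum_congr rfl fun p _ => ?_
    rcases lt_trichotomy p.1 p.2 with h | h | h
    · simp [h, h.le, h.ne]
    · simp [h]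
    · simp [h.not_ge, h.not_gt]
  rw [h1, ← Finset.sum_filter_add_sum_filter_not Finset.univ (fun p : Fin d × Fin d => p.1 ≤ p.2),
    h2, h3, ← Finset.sum_add_distrib]
  rw [← Finset.sum_subtype_eq_sum_filter, Finset.subtype_univ]
  refine Finset.sum_congr rfl fun p _ => ?_
  unfold entryVar
  split_ifs
  · simp
  · simp; ring

lemma trace_mul_eq_sum {A B : Matrix (Fin d) (Fin d) ℝ} (hA : A.IsSymm) (hB : B.IsSymm) :
    (A * B).trace = ∑ p : UpperIdx d, 2 / (entryVar p : ℝ) * (A p.1.1 p.1.2 * B p.1.1 p.1.2) := by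
  rw [← sum_sum_eq_sum_upperIdx (fun i j => A i j * B i j)
    fun i j => by rw [hA.apply i j, hB.apply i j]]
  simp only [Matrix.trace, Matrix.diag, Matrix.mul_apply]
  refine Finset.sum_congr rfl fun i _ => Finset.sum_congr rfl fun j _ => ?_
  rw [hB.apply i j]

lemma trace_mul_symmMatrix {B : Matrix (Fin d) (Fin d) ℝ} (hB : B.IsSymm) (g : UpperIdx d → ℝ) :
    (B * symmMatrix g).trace = ∑ p : UpperIdx d, 2 / (entryVar p : ℝ) * B p.1.1 p.1.2 * g p := by
  rw [trace_mul_eq_sum hB (isSymm_symmMatrix g)]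
  simp_rw [symmMatrix_apply, mul_assoc]

end Symmetric

/-! ### Gaussian shifts, Laplace transform and characteristic function of the `GOE` -/

section Gaussian

lemma gaussianReal_eq_withDensity (h : ℝ) {v : ℝ≥0} (hv : v ≠ 0) :
    gaussianReal h v = (gaussianReal 0 v).withDensity
      fun x => ENNReal.ofReal (Real.exp (h / v * x - h ^ 2 / (2 * v))) := by
  rw [gaussianReal_of_var_ne_zero _ hv, gaussianReal_of_var_ne_zero _ hv,
    ← withDensity_mul _ (measurable_gaussianPDF _ _) (by fun_prop)]
  congr 1
  ext x
  have hv' : (v : ℝ) ≠ 0 := by exact_mod_cast hv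
  simp only [gaussianPDF, Pi.mul_apply, gaussianPDFReal]
  rw [← ENNReal.ofReal_mul (by positivity), mul_assoc (_⁻¹), ← Real.exp_add]
  congr 3
  field_simp
  ring

lemma integrable_exp_gaussianReal (a b : ℝ) (v : ℝ≥0) :
    Integrable (fun x => Real.exp (a * x - b)) (gaussianReal 0 v) := by
  simp_rw [Real.exp_sub, div_eq_mul_inv]
  exact (integrable_exp_mul_gaussianReal a).mul_const _

/-- On a box both the density and the indicator factor over coordinates, so the one-dimensional
formula suffices. -/
lemma pi_withDensity_exp {ι : Type*} [Fintype ι] (v : ι → ℝ≥0) (hv : ∀ i, v i ≠ 0) (h : ι → ℝ) :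
    Measure.pi (fun i => gaussianReal (h i) (v i)) =
      (Measure.pi fun i => gaussianReal 0 (v i)).withDensity fun x =>
        ENNReal.ofReal (Real.exp (∑ i, (h i / v i * x i - h i ^ 2 / (2 * v i)))) := by
  refine Measure.pi_eq fun s hs => ?_
  set f : ι → ℝ → ℝ := fun i x => Real.exp (h i / v i * x - h i ^ 2 / (2 * v i)) with hf
  have hfi : ∀ i, Integrable ((s i).indicator (f i)) (gaussianReal 0 (v i)) := fun i =>
    (integrable_exp_gaussianReal _ _ _).indicator (hs i)
  have hf0 : ∀ i x, 0 ≤ (s i).indicator (f i) x := fun i x =>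
    Set.indicator_nonneg (fun _ _ => (Real.exp_pos _).le) _
  have hprod : ∀ x : ι → ℝ, (Set.univ.pi s).indicator (fun x : ι → ℝ =>
      ENNReal.ofReal (Real.exp (∑ i, (h i / v i * x i - h i ^ 2 / (2 * v i))))) x =
        ENNReal.ofReal (∏ i, (s i).indicator (f i) (x i)) := by
    intro x
    by_cases hx : x ∈ Set.univ.pi s
    · rw [Set.indicator_of_mem hx, Real.exp_sum]
      congr 1
      refine Finset.prod_congr rfl fun i _ => ?_
      rw [Set.indicator_of_mem (hx i trivial)]
    · rw [Set.indicator_of_notMem hx]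
      simp only [Set.mem_pi, Set.mem_univ, true_implies, not_forall] at hx
      obtain ⟨i, hi⟩ := hx
      rw [Finset.prod_eq_zero (Finset.mem_univ i) (Set.indicator_of_notMem hi _),
        ENNReal.ofReal_zero]
  rw [withDensity_apply _ (MeasurableSet.univ_pi hs),
    ← lintegral_indicator (MeasurableSet.univ_pi hs)]
  simp_rw [hprod]
  rw [← ofReal_integral_eq_lintegral_ofReal (Integrable.fintype_prod_dep hfi)
    (Filter.Eventually.of_forall fun x => Finset.prod_nonneg fun i _ => hf0 i _),
    integral_fintype_prod_eq_prod,
    ENNReal.ofReal_prod_of_nonneg fun i _ => integral_nonneg (hf0 i)]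
  refine Finset.prod_congr rfl fun i _ => ?_
  rw [ofReal_integral_eq_lintegral_ofReal (hfi i) (Filter.Eventually.of_forall (hf0 i)),
    gaussianReal_eq_withDensity (h i) (hv i), withDensity_apply _ (hs i), ← lintegral_indicator (hs i)]
  refine lintegral_congr fun x => ?_
  by_cases hx : x ∈ s i <;> simp [hx, hf]

variable {d : ℕ}

/-- The **Cameron–Martin formula** for the Gaussian orthogonal ensemble. -/
lemma lintegral_goeEntries_add {H : Matrix (Fin d) (Fin d) ℝ} (hH : H.IsSymm)
    {f : (UpperIdx d → ℝ) → ℝ≥0∞} (hf : Measurable f) :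
    ∫⁻ g, f (g + upperPart H) ∂goeEntries d = ∫⁻ g, f g * ENNReal.ofReal
      (Real.exp ((H * symmMatrix g).trace / 2 - (H * H).trace / 4)) ∂goeEntries d := by
  have h1 : (goeEntries d).map (fun g => g + upperPart H) =
      Measure.pi fun p : UpperIdx d => gaussianReal (upperPart H p) (entryVar p) := by
    rw [goeEntries_eq]
    have := Measure.pi_map_pi (μ := fun p : UpperIdx d => gaussianReal 0 (entryVar p))
      (f := fun p x => x + upperPart H p) (fun p => by fun_prop)
    simp_rw [gaussianReal_map_add_const, zero_add] at this
    exact this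
  have h2 : ∀ g : UpperIdx d → ℝ, (H * symmMatrix g).trace / 2 - (H * H).trace / 4 =
      ∑ p, (upperPart H p / entryVar p * g p - upperPart H p ^ 2 / (2 * entryVar p)) := by
    intro g
    rw [trace_mul_symmMatrix hH, trace_mul_eq_sum hH hH, Finset.sum_div, Finset.sum_div,
      ← Finset.sum_sub_distrib]
    refine Finset.sum_congr rfl fun p _ => ?_
    have := (entryVar_pos p).ne'
    simp only [upperPart]
    field_simp
    ring
  simp_rw [h2]
  rw [← lintegral_map hf (by fun_prop), h1, pi_withDensity_exp _ entryVar_ne_zero,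
    lintegral_withDensity_eq_lintegral_mul _ (by fun_prop) hf, goeEntries_eq]
  exact lintegral_congr fun g => mul_comm _ _

lemma measurable_symmMatrix_apply (i j : Fin d) :
    Measurable fun g : UpperIdx d → ℝ => symmMatrix g i j := by
  simp only [symmMatrix, Matrix.of_apply]
  fun_prop

/-- Cameron–Martin for the constant function 1 says that the shifted density has total mass one. -/
lemma lintegral_exp_trace {B : Matrix (Fin d) (Fin d) ℝ} (hB : B.IsSymm) :
    ∫⁻ g, ENNReal.ofReal (Real.exp ((B * symmMatrix g).trace / 2)) ∂goeEntries d =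
      ENNReal.ofReal (Real.exp ((B * B).trace / 4)) := by
  have h := lintegral_goeEntries_add hB (f := fun _ => 1) measurable_const
  simp only [lintegral_const, measure_univ, mul_one, one_mul] at h
  have h' : ∀ g : UpperIdx d → ℝ, ENNReal.ofReal (Real.exp ((B * symmMatrix g).trace / 2)) =
      ENNReal.ofReal (Real.exp ((B * symmMatrix g).trace / 2 - (B * B).trace / 4)) *
        ENNReal.ofReal (Real.exp ((B * B).trace / 4)) := by
    intro g
    rw [← ENNReal.ofReal_mul (Real.exp_pos _).le, ← Real.exp_add, sub_add_cancel]
  simp_rw [h']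
  rw [lintegral_mul_const' _ _ ENNReal.ofReal_ne_top, ← h, one_mul]

/-- The variable tr(BW) is centred Gaussian of variance 2 tr(B²), by independence of the entries. -/
lemma integral_cexp_trace {B : Matrix (Fin d) (Fin d) ℝ} (hB : B.IsSymm) :
    ∫ g, Complex.exp ((B * symmMatrix g).trace * Complex.I) ∂goeEntries d =
      Complex.exp (-((B * B).trace : ℝ)) := by
  simp_rw [trace_mul_symmMatrix hB, Complex.ofReal_sum, Finset.sum_mul, Complex.exp_sum]
  rw [goeEntries_eq, integral_fintype_prod_eq_prod (fun (p : UpperIdx d) (x : ℝ) =>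
    Complex.exp (((2 / (entryVar p : ℝ) * B p.1.1 p.1.2 * x : ℝ) : ℂ) * Complex.I)),
    trace_mul_eq_sum hB hB, Complex.ofReal_sum, ← Finset.sum_neg_distrib, Complex.exp_sum]
  refine Finset.prod_congr rfl fun p _ => ?_
  have h := charFun_gaussianReal (μ := 0) (v := entryVar p) (2 / (entryVar p : ℝ) * B p.1.1 p.1.2)
  rw [charFun_apply_real] at h
  have hv : (entryVar p : ℂ) ≠ 0 := by exact_mod_cast entryVar_ne_zero p
  refine Eq.trans ?_ (h.trans ?_)
  · simp only [Complex.ofReal_mul]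
  · congr 1
    push_cast
    field_simp
    ring

end Gaussian

/-! ### Orthogonal projections and replacement of a block -/

section Projection

variable {d : ℕ}

/-- `Q` is the matrix of an orthogonal projection. -/
structure IsOrthProj (Q : Matrix (Fin d) (Fin d) ℝ) : Prop where
  isSymm : Q.IsSymm
  mul_self : Q * Q = Q

lemma isOrthProj_one : IsOrthProj (1 : Matrix (Fin d) (Fin d) ℝ) :=
  ⟨Matrix.isSymm_one, mul_one 1⟩

lemma IsOrthProj.isSymm_conj {Q A : Matrix (Fin d) (Fin d) ℝ} (hQ : IsOrthProj Q)
    (hA : A.IsSymm) : (Q * A * Q).IsSymm := by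
  unfold Matrix.IsSymm
  rw [Matrix.transpose_mul, Matrix.transpose_mul, hQ.isSymm.eq, hA.eq, mul_assoc]

/-- Replace the block of `A` on the range of `Q` by that of `B`. -/
def resampleMatrix (Q A B : Matrix (Fin d) (Fin d) ℝ) : Matrix (Fin d) (Fin d) ℝ :=
  A - Q * A * Q + Q * B * Q

lemma IsOrthProj.isSymm_resampleMatrix {Q A B : Matrix (Fin d) (Fin d) ℝ} (hQ : IsOrthProj Q)
    (hA : A.IsSymm) (hB : B.IsSymm) : (resampleMatrix Q A B).IsSymm :=
  (hA.sub (hQ.isSymm_conj hA)).add (hQ.isSymm_conj hB)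

lemma trace_mul_conj (Q A B : Matrix (Fin d) (Fin d) ℝ) :
    (A * (Q * B * Q)).trace = (Q * A * Q * B).trace := by
  rw [← mul_assoc, Matrix.trace_mul_comm]
  simp only [mul_assoc]

lemma IsOrthProj.trace_conj_mul_conj {Q : Matrix (Fin d) (Fin d) ℝ} (hQ : IsOrthProj Q)
    (A B : Matrix (Fin d) (Fin d) ℝ) :
    (Q * A * Q * (Q * B * Q)).trace = (A * (Q * B * Q)).trace := by
  have : Q * A * Q * (Q * B * Q) = Q * (A * (Q * B * Q)) := by
    simp only [mul_assoc]
    rw [← mul_assoc Q Q, hQ.mul_self]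
  rw [this, Matrix.trace_mul_comm, mul_assoc, mul_assoc, hQ.mul_self]

lemma trace_mul_resampleMatrix (Q H A B : Matrix (Fin d) (Fin d) ℝ) :
    (H * resampleMatrix Q A B).trace =
      ((H - Q * H * Q) * A).trace + (Q * H * Q * B).trace := by
  rw [resampleMatrix, mul_add, mul_sub, Matrix.trace_add, Matrix.trace_sub, trace_mul_conj,
    trace_mul_conj, sub_mul, Matrix.trace_sub]

/-- The range of R lies in that of Q, so the inner block is overwritten by C in either order of
replacement. -/
lemma resampleMatrix_resampleMatrix {Q R : Matrix (Fin d) (Fin d) ℝ} (hQR : Q * R = R)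
    (hRQ : R * Q = R) (A B C : Matrix (Fin d) (Fin d) ℝ) :
    resampleMatrix Q A (resampleMatrix R B C) = resampleMatrix R (resampleMatrix Q A B) C := by
  have h : ∀ X : Matrix (Fin d) (Fin d) ℝ, Q * (R * X * R) * Q = R * X * R := fun X => by
    rw [← mul_assoc, ← mul_assoc, hQR, mul_assoc, hRQ]
  have h' : ∀ X : Matrix (Fin d) (Fin d) ℝ, R * (Q * X * Q) * R = R * X * R := fun X => by
    rw [← mul_assoc, ← mul_assoc, hRQ, mul_assoc, hQR]
  simp only [resampleMatrix, mul_add, mul_sub, add_mul, sub_mul, h, h']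
  abel

/-- Remove the direction `Q v` from the orthogonal projection `Q`. -/
def deflate (Q : Matrix (Fin d) (Fin d) ℝ) (v : Fin d → ℝ) : Matrix (Fin d) (Fin d) ℝ :=
  Q - ((Q *ᵥ v) ⬝ᵥ (Q *ᵥ v))⁻¹ • vecMulVec (Q *ᵥ v) (Q *ᵥ v)

lemma IsOrthProj.mulVec_mulVec {Q : Matrix (Fin d) (Fin d) ℝ} (hQ : IsOrthProj Q)
    (v : Fin d → ℝ) : Q *ᵥ (Q *ᵥ v) = Q *ᵥ v := by
  rw [Matrix.mulVec_mulVec, hQ.mul_self]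

lemma IsOrthProj.vecMul_eq {Q : Matrix (Fin d) (Fin d) ℝ} (hQ : IsOrthProj Q)
    (v : Fin d → ℝ) : v ᵥ* Q = Q *ᵥ v := by
  rw [← Matrix.mulVec_transpose, hQ.isSymm.eq]

lemma IsOrthProj.dotProduct_mulVec {Q : Matrix (Fin d) (Fin d) ℝ} (hQ : IsOrthProj Q)
    (v w : Fin d → ℝ) : (Q *ᵥ v) ⬝ᵥ (Q *ᵥ w) = v ⬝ᵥ (Q *ᵥ w) := by
  rw [← hQ.vecMul_eq v, ← Matrix.dotProduct_mulVec, hQ.mulVec_mulVec]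

lemma IsOrthProj.mul_deflate {Q : Matrix (Fin d) (Fin d) ℝ} (hQ : IsOrthProj Q)
    (v : Fin d → ℝ) : Q * deflate Q v = deflate Q v := by
  rw [deflate, mul_sub, hQ.mul_self, Matrix.mul_smul, Matrix.mul_vecMulVec, hQ.mulVec_mulVec]

lemma IsOrthProj.deflate_mul {Q : Matrix (Fin d) (Fin d) ℝ} (hQ : IsOrthProj Q)
    (v : Fin d → ℝ) : deflate Q v * Q = deflate Q v := by
  rw [deflate, sub_mul, hQ.mul_self, Matrix.smul_mul, Matrix.vecMulVec_mul, hQ.vecMul_eq,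
    hQ.mulVec_mulVec]

/-- This covers y = 0, where the inverse is 0: a query already in the span of the earlier ones
leaves the projection unchanged. -/
lemma inv_mul_self_smul (y : Fin d → ℝ) : ((y ⬝ᵥ y)⁻¹ * (y ⬝ᵥ y)) • y = y := by
  by_cases hy : y ⬝ᵥ y = 0
  · rw [dotProduct_self_eq_zero.1 hy, smul_zero]
  · rw [inv_mul_cancel₀ hy, one_smul]

lemma IsOrthProj.deflate_mulVec {Q : Matrix (Fin d) (Fin d) ℝ} (hQ : IsOrthProj Q)
    (v : Fin d → ℝ) : deflate Q v *ᵥ v = 0 := by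
  rw [deflate, Matrix.sub_mulVec, Matrix.smul_mulVec, Matrix.vecMulVec_mulVec]
  have : (Q *ᵥ v) ⬝ᵥ v = (Q *ᵥ v) ⬝ᵥ (Q *ᵥ v) := by
    rw [hQ.dotProduct_mulVec, dotProduct_comm]
  rw [this, op_smul_eq_smul, smul_smul, inv_mul_self_smul, sub_self]

lemma IsOrthProj.deflate {Q : Matrix (Fin d) (Fin d) ℝ} (hQ : IsOrthProj Q) (v : Fin d → ℝ) :
    IsOrthProj (deflate Q v) := by
  have h1 : (vecMulVec (Q *ᵥ v) (Q *ᵥ v)).IsSymm := by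
    unfold Matrix.IsSymm; rw [Matrix.transpose_vecMulVec]
  have h0 : SpikedQuery.deflate Q v *ᵥ (Q *ᵥ v) = 0 := by
    rw [Matrix.mulVec_mulVec, hQ.deflate_mul, hQ.deflate_mulVec]
  refine ⟨hQ.isSymm.sub (h1.smul _), ?_⟩
  conv_lhs => enter [2]; rw [SpikedQuery.deflate]
  rw [mul_sub, hQ.deflate_mul, Matrix.mul_smul, Matrix.mul_vecMulVec, h0]
  simp

end Projection

/-! ### Invariance of the `GOE` under resampling of a block -/

section Resampling

variable {d : ℕ}

/-- Upper entries of the matrix with entries `g`, its block on the range of `Q` being replaced by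
that of the matrix with entries `g'`. -/
def resample (Q : Matrix (Fin d) (Fin d) ℝ) (g g' : UpperIdx d → ℝ) : UpperIdx d → ℝ :=
  upperPart (resampleMatrix Q (symmMatrix g) (symmMatrix g'))

lemma IsOrthProj.symmMatrix_resample {Q : Matrix (Fin d) (Fin d) ℝ} (hQ : IsOrthProj Q)
    (g g' : UpperIdx d → ℝ) :
    symmMatrix (resample Q g g') = resampleMatrix Q (symmMatrix g) (symmMatrix g') :=
  symmMatrix_upperPart (hQ.isSymm_resampleMatrix (isSymm_symmMatrix g) (isSymm_symmMatrix g'))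

lemma measurable_resample {X : Type*} [MeasurableSpace X] {Q : X → Matrix (Fin d) (Fin d) ℝ}
    {g g' : X → UpperIdx d → ℝ} (hQ : ∀ i j, Measurable fun x => Q x i j)
    (hg : Measurable g) (hg' : Measurable g') :
    Measurable fun x => resample (Q x) (g x) (g' x) := by
  have h1 : ∀ i j, Measurable fun x => symmMatrix (g x) i j := fun i j =>
    (measurable_symmMatrix_apply i j).comp hg
  have h2 : ∀ i j, Measurable fun x => symmMatrix (g' x) i j := fun i j =>
    (measurable_symmMatrix_apply i j).comp hg'
  refine measurable_pi_lambda _ fun p => ?_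
  simp only [resample, upperPart, resampleMatrix, Matrix.add_apply, Matrix.sub_apply,
    Matrix.mul_apply]
  fun_prop

/-- Replacing a block of a `GOE` matrix by that of an independent copy does not change its law. -/
lemma map_resample_goeEntries {Q : Matrix (Fin d) (Fin d) ℝ} (hQ : IsOrthProj Q) :
    ((goeEntries d).prod (goeEntries d)).map (fun p => resample Q p.1 p.2) = goeEntries d := by
  have hm : Measurable fun p : (UpperIdx d → ℝ) × (UpperIdx d → ℝ) => resample Q p.1 p.2 :=
    measurable_resample (fun _ _ => measurable_const) measurable_fst measurable_snd
  have : IsFiniteMeasure (((goeEntries d).prod (goeEntries d)).map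
    fun p => resample Q p.1 p.2) := inferInstance
  refine Measure.ext_of_charFunDual (funext fun L => ?_)
  -- Every linear functional of the upper entries is a trace against a symmetric matrix; the factor
  -- `entryVar`/2 cancels the weight in the trace form.
  set B : Matrix (Fin d) (Fin d) ℝ :=
    symmMatrix fun p => (entryVar p : ℝ) / 2 * L (Pi.single p 1) with hBdef
  have hB : B.IsSymm := isSymm_symmMatrix _
  have hL : ∀ g, L g = (B * symmMatrix g).trace := by
    intro g
    rw [trace_mul_symmMatrix hB]
    conv_lhs => rw [pi_eq_sum_univ' g, map_sum]
    refine Finset.sum_congr rfl fun p _ => ?_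
    have := (entryVar_pos p).ne'
    rw [hBdef, symmMatrix_apply, map_smul, smul_eq_mul]
    field_simp
  have hc : (Q * B * Q).IsSymm := hQ.isSymm_conj hB
  rw [charFunDual_apply, charFunDual_apply, integral_map hm.aemeasurable (by fun_prop)]
  simp_rw [hL, hQ.symmMatrix_resample, trace_mul_resampleMatrix, Complex.ofReal_add, add_mul,
    Complex.exp_add]
  rw [integral_prod_mul (fun g : UpperIdx d → ℝ => Complex.exp
      (((B - Q * B * Q) * symmMatrix g).trace * Complex.I))
    (fun g : UpperIdx d → ℝ => Complex.exp ((Q * B * Q * symmMatrix g).trace * Complex.I)),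
    integral_cexp_trace (hB.sub hc), integral_cexp_trace hc, integral_cexp_trace hB,
    ← Complex.exp_add]
  congr 1
  -- B − QBQ and QBQ are orthogonal for the trace form, so the two variances add up to that of
  -- tr(BW).
  rw [← neg_add, ← Complex.ofReal_add]
  congr 2
  rw [sub_mul, mul_sub, mul_sub, hQ.trace_conj_mul_conj]
  simp only [Matrix.trace_sub]
  rw [hQ.trace_conj_mul_conj, Matrix.trace_mul_comm (Q * B * Q) B]
  ring

lemma lintegral_lintegral_resample {Q : Matrix (Fin d) (Fin d) ℝ} (hQ : IsOrthProj Q)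
    {f : (UpperIdx d → ℝ) → ℝ≥0∞} (hf : Measurable f) :
    ∫⁻ g, ∫⁻ g', f (resample Q g g') ∂goeEntries d ∂goeEntries d = ∫⁻ g, f g ∂goeEntries d := by
  have hm : Measurable fun p : (UpperIdx d → ℝ) × (UpperIdx d → ℝ) => resample Q p.1 p.2 :=
    measurable_resample (fun _ _ => measurable_const) measurable_fst measurable_snd
  conv_rhs => rw [← map_resample_goeEntries hQ, lintegral_map hf hm]
  exact (lintegral_prod _ (hf.comp hm).aemeasurable).symm

end Resampling

/-! ### The unobserved block given an adaptive transcript -/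

section Adaptive

variable {d T : ℕ} {Ξ : Type*} [MeasurableSpace Ξ]

/-- Projection onto the orthogonal complement of the queries of a transcript. -/
def complProj : (k : ℕ) → (Fin k → Vec d × Vec d) → Matrix (Fin d) (Fin d) ℝ
  | 0, _ => 1
  | k + 1, z => deflate (complProj k (Fin.init z)) (z (Fin.last k)).1.ofLp

lemma isOrthProj_complProj (k : ℕ) (z : Fin k → Vec d × Vec d) : IsOrthProj (complProj k z) := by
  induction k with
  | zero => exact isOrthProj_one
  | succ k ih => exact (ih _).deflate _

lemma measurable_mulVec_apply {X : Type*} [MeasurableSpace X] {Q : X → Matrix (Fin d) (Fin d) ℝ}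
    {v : X → Fin d → ℝ} (hQ : ∀ i j, Measurable fun x => Q x i j) (hv : Measurable v)
    (i : Fin d) : Measurable fun x => (Q x *ᵥ v x) i := by
  simp only [Matrix.mulVec, dotProduct]
  fun_prop

lemma measurable_deflate {X : Type*} [MeasurableSpace X] {Q : X → Matrix (Fin d) (Fin d) ℝ}
    {v : X → Fin d → ℝ} (hQ : ∀ i j, Measurable fun x => Q x i j) (hv : Measurable v)
    (i j : Fin d) : Measurable fun x => deflate (Q x) (v x) i j := by
  have h := measurable_mulVec_apply hQ hv
  simp only [deflate, Matrix.sub_apply, Matrix.smul_apply, Matrix.vecMulVec_apply, smul_eq_mul,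
    dotProduct]
  fun_prop

lemma measurable_complProj (k : ℕ) (i j : Fin d) :
    Measurable fun z : Fin k → Vec d × Vec d => complProj k z i j := by
  induction k generalizing i j with
  | zero => exact measurable_const
  | succ k ih =>
    refine measurable_deflate (Q := fun z : Fin (k + 1) → Vec d × Vec d =>
      complProj k (Fin.init z)) (fun i j => ?_) ?_ i j
    · exact (ih i j).comp (measurable_pi_lambda _ fun i => measurable_pi_apply _)
    · exact (WithLp.measurable_ofLp 2 _).comp (measurable_pi_apply (Fin.last k)).fst

/-- The null model `W / √d`. -/
def nullMatrix (g : UpperIdx d → ℝ) : Matrix (Fin d) (Fin d) ℝ :=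
  (1 / Real.sqrt d) • symmMatrix g

/-- The transcript of the first `k` rounds under the null model. -/
def nullTranscript (A : QueryAlgorithm d T Ξ) (ξ : Ξ) (k : ℕ) (hk : k ≤ T)
    (g : UpperIdx d → ℝ) : Fin k → Vec d × Vec d :=
  A.transcriptUpTo (nullMatrix g) ξ k hk

lemma spikedMatrix_zero (lam : ℝ) (g : UpperIdx d → ℝ) : spikedMatrix lam 0 g = nullMatrix g := by
  ext i j
  simp [spikedMatrix, nullMatrix]

lemma measurable_nullTranscript (A : QueryAlgorithm d T Ξ) (ξ : Ξ) (k : ℕ) (hk : k ≤ T) :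
    Measurable (nullTranscript A ξ k hk) := by
  have h := (measurable_transcriptUpTo A 0 k hk).comp
    (measurable_const.prodMk (measurable_id.prodMk measurable_const) :
      Measurable fun g : UpperIdx d → ℝ => ((0 : Vec d), (g, ξ)))
  simp only [Function.comp_def, spikedMatrix_zero] at h
  exact h

/-- The query asked in round `k` after the transcript `z`. -/
def nextQuery (A : QueryAlgorithm d T Ξ) (ξ : Ξ) {k : ℕ} (hk : k + 1 ≤ T)
    (z : Fin k → Vec d × Vec d) : Vec d := A.query ⟨k, hk⟩ ξ z

lemma measurable_nextQuery (A : QueryAlgorithm d T Ξ) (ξ : Ξ) {k : ℕ} (hk : k + 1 ≤ T) :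
    Measurable (nextQuery A ξ hk) :=
  (A.measurable_query ⟨k, hk⟩).comp measurable_prodMk_left

lemma nullTranscript_succ (A : QueryAlgorithm d T Ξ) (ξ : Ξ) {k : ℕ} (hk : k + 1 ≤ T)
    (g : UpperIdx d → ℝ) :
    nullTranscript A ξ (k + 1) hk g =
      Fin.snoc (α := fun _ => Vec d × Vec d) (nullTranscript A ξ k (Nat.le_of_succ_le hk) g)
        (nextQuery A ξ hk (nullTranscript A ξ k (Nat.le_of_succ_le hk) g),
          mulV (nullMatrix g)
            (nextQuery A ξ hk (nullTranscript A ξ k (Nat.le_of_succ_le hk) g))) := rfl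

lemma complProj_snoc {k : ℕ} (z : Fin k → Vec d × Vec d) (v w : Vec d) :
    complProj (k + 1) (Fin.snoc (α := fun _ => Vec d × Vec d) z (v, w)) =
      deflate (complProj k z) v.ofLp := by
  simp [complProj]

lemma measurable_snoc {X : Type*} [MeasurableSpace X] {k : ℕ} {z : X → Fin k → Vec d × Vec d}
    {a : X → Vec d × Vec d} (hz : Measurable z) (ha : Measurable a) :
    Measurable fun x => Fin.snoc (α := fun _ => Vec d × Vec d) (z x) (a x) := by
  refine measurable_pi_lambda _ fun i => ?_
  refine Fin.lastCases ?_ (fun j => ?_) i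
  · simpa using ha
  · simpa [Function.comp_def] using (measurable_pi_apply j).comp hz

lemma measurable_mulV_nullMatrix {X : Type*} [MeasurableSpace X] {g : X → UpperIdx d → ℝ}
    {v : X → Vec d} (hg : Measurable g) (hv : Measurable v) :
    Measurable fun x => mulV (nullMatrix (g x)) (v x) := by
  refine (WithLp.measurable_toLp 2 _).comp (measurable_pi_lambda _ fun i => ?_)
  refine measurable_mulVec_apply (fun i j => ?_) ((WithLp.measurable_ofLp 2 _).comp hv) i
  have h := (measurable_symmMatrix_apply i j).comp hg
  simp only [nullMatrix, Matrix.smul_apply, smul_eq_mul]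
  exact measurable_const.mul h

lemma mulVec_nullMatrix_resample {Q : Matrix (Fin d) (Fin d) ℝ} (hQ : IsOrthProj Q)
    {v : Vec d} (hv : Q *ᵥ v.ofLp = 0) (g g' : UpperIdx d → ℝ) :
    mulV (nullMatrix (resample Q g g')) v = mulV (nullMatrix g) v := by
  simp only [mulV, nullMatrix, Matrix.smul_mulVec, hQ.symmMatrix_resample, resampleMatrix,
    Matrix.add_mulVec, Matrix.sub_mulVec, ← Matrix.mulVec_mulVec, hv, Matrix.mulVec_zero,
    sub_zero, add_zero]

/-- Given the transcript, the block of the noise on the orthogonal complement of the queries is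
still a `GOE` block, even if the queries are adaptive. -/
lemma lintegral_nullTranscript_resample (A : QueryAlgorithm d T Ξ) (ξ : Ξ) (k : ℕ) (hk : k ≤ T)
    {F : (Fin k → Vec d × Vec d) × (UpperIdx d → ℝ) → ℝ≥0∞} (hF : Measurable F) :
    ∫⁻ g, F (nullTranscript A ξ k hk g, g) ∂goeEntries d =
      ∫⁻ g, ∫⁻ g', F (nullTranscript A ξ k hk g,
        resample (complProj k (nullTranscript A ξ k hk g)) g g') ∂goeEntries d ∂goeEntries d := by
  induction k with
  | zero =>
    have h : ∀ g, nullTranscript A ξ 0 hk g = Fin.elim0 := fun _ => rfl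
    simp only [h]
    exact (lintegral_lintegral_resample (isOrthProj_complProj 0 _)
      (hF.comp measurable_prodMk_left)).symm
  | succ k ih =>
    have hk' := Nat.le_of_succ_le hk
    set v := nextQuery A ξ hk with hv
    have hvm : Measurable v := measurable_nextQuery A ξ hk
    set Q' : (Fin k → Vec d × Vec d) → Matrix (Fin d) (Fin d) ℝ :=
      fun z => deflate (complProj k z) (v z).ofLp with hQ'
    have hQ'm : ∀ i j, Measurable fun z => Q' z i j :=
      measurable_deflate (measurable_complProj k) ((WithLp.measurable_ofLp 2 _).comp hvm)
    have hQ'p : ∀ z, IsOrthProj (Q' z) := fun z => (isOrthProj_complProj k z).deflate _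
    -- Round k + 1 is a function of the first k rounds and the noise, so the induction hypothesis
    -- applies to `F₁`. It applies again to `F₂`, in which the smaller block, on the range of `Q'`,
    -- is resampled as well.
    set F₁ : (Fin k → Vec d × Vec d) × (UpperIdx d → ℝ) → ℝ≥0∞ := fun p =>
      F (Fin.snoc (α := fun _ => Vec d × Vec d) p.1 (v p.1, mulV (nullMatrix p.2) (v p.1)), p.2)
      with hF₁
    have hF₁m : Measurable F₁ := by
      refine hF.comp (Measurable.prodMk (measurable_snoc measurable_fst
        ((hvm.comp measurable_fst).prodMk ?_)) measurable_snd)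
      exact measurable_mulV_nullMatrix measurable_snd (hvm.comp measurable_fst)
    set F₂ : (Fin k → Vec d × Vec d) × (UpperIdx d → ℝ) → ℝ≥0∞ := fun p =>
      ∫⁻ g'', F₁ (p.1, resample (Q' p.1) p.2 g'') ∂goeEntries d with hF₂
    have hF₂m : Measurable F₂ := by
      refine Measurable.lintegral_prod_right' (f := fun q :
        ((Fin k → Vec d × Vec d) × (UpperIdx d → ℝ)) × (UpperIdx d → ℝ) =>
          F₁ (q.1.1, resample (Q' q.1.1) q.1.2 q.2)) ?_
      refine hF₁m.comp (Measurable.prodMk (by fun_prop) (measurable_resample (fun i j => ?_)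
        (by fun_prop) (by fun_prop)))
      exact (hQ'm i j).comp (by fun_prop)
    calc ∫⁻ g, F (nullTranscript A ξ (k + 1) hk g, g) ∂goeEntries d
        = ∫⁻ g, F₁ (nullTranscript A ξ k hk' g, g) ∂goeEntries d := rfl
      _ = ∫⁻ g, ∫⁻ g', F₁ (nullTranscript A ξ k hk' g,
            resample (complProj k (nullTranscript A ξ k hk' g)) g g')
              ∂goeEntries d ∂goeEntries d := ih hk' hF₁m
      _ = ∫⁻ g, ∫⁻ g', F₂ (nullTranscript A ξ k hk' g,
            resample (complProj k (nullTranscript A ξ k hk' g)) g g')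
              ∂goeEntries d ∂goeEntries d := by
          refine lintegral_congr fun g => ?_
          set z := nullTranscript A ξ k hk' g
          have hP := isOrthProj_complProj k z
          have hm : Measurable fun g' => F₁ (z, resample (complProj k z) g g') :=
            hF₁m.comp (measurable_const.prodMk (measurable_resample
              (fun _ _ => measurable_const) measurable_const measurable_id))
          rw [← lintegral_lintegral_resample (hQ'p z) hm]
          -- The extra resampling was made on the fresh copy, with z held fixed; it is now moved
          -- onto the resampled noise, so that the induction hypothesis can be used backwards.
          refine lintegral_congr fun g' => lintegral_congr fun g'' => ?_
          congr 2
          unfold resample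
          rw [symmMatrix_upperPart ((hQ'p z).isSymm_resampleMatrix (isSymm_symmMatrix _)
              (isSymm_symmMatrix _)),
            symmMatrix_upperPart (hP.isSymm_resampleMatrix (isSymm_symmMatrix _)
              (isSymm_symmMatrix _)),
            resampleMatrix_resampleMatrix (hP.mul_deflate _) (hP.deflate_mul _)]
      _ = ∫⁻ g, F₂ (nullTranscript A ξ k hk' g, g) ∂goeEntries d := (ih hk' hF₂m).symm
      _ = _ := by
          refine lintegral_congr fun g => lintegral_congr fun g'' => ?_
          have hP := isOrthProj_complProj k (nullTranscript A ξ k hk' g)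
          simp only [hF₁]
          -- `Q'` kills the new query, so resampling its block does not alter the response.
          rw [mulVec_nullMatrix_resample (hQ'p _) (hP.deflate_mulVec _), nullTranscript_succ,
            complProj_snoc]

end Adaptive

/-! ### Likelihood ratio of the observed part of the noise -/

section Likelihood

variable {d T : ℕ} {Ξ : Type*} [MeasurableSpace Ξ]

/-- Likelihood ratio, at the matrix `W` with upper entries `g`, of the laws of `W + H` and `W`, of
which everything but the block on the range of `Q` is observed. -/
def likelihood (Q H : Matrix (Fin d) (Fin d) ℝ) (g : UpperIdx d → ℝ) : ℝ≥0∞ :=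
  ENNReal.ofReal (Real.exp (((H - Q * H * Q) * symmMatrix g).trace / 2 -
    ((H * H).trace - (Q * H * Q * (Q * H * Q)).trace) / 4))

lemma measurable_trace_mul {X : Type*} [MeasurableSpace X] {M N : X → Matrix (Fin d) (Fin d) ℝ}
    (hM : ∀ i j, Measurable fun x => M x i j) (hN : ∀ i j, Measurable fun x => N x i j) :
    Measurable fun x => (M x * N x).trace := by
  simp only [Matrix.trace, Matrix.diag, Matrix.mul_apply]
  fun_prop

lemma measurable_mul_apply {X : Type*} [MeasurableSpace X] {M N : X → Matrix (Fin d) (Fin d) ℝ}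
    (hM : ∀ i j, Measurable fun x => M x i j) (hN : ∀ i j, Measurable fun x => N x i j)
    (i j : Fin d) : Measurable fun x => (M x * N x) i j := by
  simp only [Matrix.mul_apply]
  fun_prop

lemma measurable_likelihood {X : Type*} [MeasurableSpace X] {Q H : X → Matrix (Fin d) (Fin d) ℝ}
    {g : X → UpperIdx d → ℝ} (hQ : ∀ i j, Measurable fun x => Q x i j)
    (hH : ∀ i j, Measurable fun x => H x i j) (hg : Measurable g) :
    Measurable fun x => likelihood (Q x) (H x) (g x) := by
  have hc := measurable_mul_apply (measurable_mul_apply hQ hH) hQ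
  have h1 := measurable_trace_mul (M := fun x => H x - Q x * H x * Q x)
    (N := fun x => symmMatrix (g x)) (fun i j => (hH i j).sub (hc i j))
    (fun i j => (measurable_symmMatrix_apply i j).comp hg)
  have h2 := measurable_trace_mul hH hH
  have h3 := measurable_trace_mul hc hc
  unfold likelihood
  fun_prop

/-- With Q = 0 everything is observed and the ratio is the full Cameron–Martin density. Resampling
the hidden block separates its contribution, a Laplace transform whose value exp(tr((QHQ)²)/4)
yields the ratio of the transcript. -/
lemma lintegral_nullTranscript_mul_likelihood_zero (A : QueryAlgorithm d T Ξ) (ξ : Ξ) (k : ℕ)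
    (hk : k ≤ T) {H : Matrix (Fin d) (Fin d) ℝ} (hH : H.IsSymm)
    {f : (Fin k → Vec d × Vec d) → ℝ≥0∞} (hf : Measurable f) :
    ∫⁻ g, f (nullTranscript A ξ k hk g) * likelihood 0 H g ∂goeEntries d =
      ∫⁻ g, f (nullTranscript A ξ k hk g) *
        likelihood (complProj k (nullTranscript A ξ k hk g)) H g ∂goeEntries d := by
  have hF : Measurable fun p : (Fin k → Vec d × Vec d) × (UpperIdx d → ℝ) =>
      f p.1 * likelihood 0 H p.2 :=
    (hf.comp measurable_fst).mul (measurable_likelihood (fun _ _ => measurable_const)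
      (fun _ _ => measurable_const) measurable_snd)
  rw [lintegral_nullTranscript_resample A ξ k hk hF]
  refine lintegral_congr fun g => ?_
  set z := nullTranscript A ξ k hk g
  set Q := complProj k z
  have hQ : IsOrthProj Q := isOrthProj_complProj k z
  have hc := hQ.isSymm_conj hH
  have hm : Measurable fun g' => likelihood 0 H (resample Q g g') :=
    measurable_likelihood (Q := fun _ => 0) (H := fun _ => H) (fun _ _ => measurable_const)
      (fun _ _ => measurable_const) (measurable_resample (Q := fun _ => Q)
        (fun _ _ => measurable_const) measurable_const measurable_id)
  change ∫⁻ g', f z * likelihood 0 H (resample Q g g') ∂goeEntries d = f z * likelihood Q H g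
  rw [lintegral_const_mul _ hm]
  congr 1
  have h : ∀ g', likelihood 0 H (resample Q g g') =
      ENNReal.ofReal (Real.exp (((H - Q * H * Q) * symmMatrix g).trace / 2 - (H * H).trace / 4)) *
        ENNReal.ofReal (Real.exp ((Q * H * Q * symmMatrix g').trace / 2)) := by
    intro g'
    rw [← ENNReal.ofReal_mul (Real.exp_pos _).le, ← Real.exp_add, likelihood,
      hQ.symmMatrix_resample]
    simp only [zero_mul, sub_zero, Matrix.trace_zero, mul_zero]
    rw [trace_mul_resampleMatrix]
    ring_nf
  simp_rw [h]
  rw [lintegral_const_mul' _ _ ENNReal.ofReal_ne_top, lintegral_exp_trace hc,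
    ← ENNReal.ofReal_mul (Real.exp_pos _).le, ← Real.exp_add, likelihood]
  ring_nf

lemma lintegral_nullTranscript_add (A : QueryAlgorithm d T Ξ) (ξ : Ξ) (k : ℕ)
    (hk : k ≤ T) {H : Matrix (Fin d) (Fin d) ℝ} (hH : H.IsSymm)
    {f : (Fin k → Vec d × Vec d) → ℝ≥0∞} (hf : Measurable f) :
    ∫⁻ g, f (nullTranscript A ξ k hk (g + upperPart H)) ∂goeEntries d =
      ∫⁻ g, f (nullTranscript A ξ k hk g) *
        likelihood (complProj k (nullTranscript A ξ k hk g)) H g ∂goeEntries d := by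
  rw [lintegral_goeEntries_add hH (f := fun g => f (nullTranscript A ξ k hk g))
      (hf.comp (measurable_nullTranscript A ξ k hk)),
    ← lintegral_nullTranscript_mul_likelihood_zero A ξ k hk hH hf]
  simp [likelihood]

lemma lintegral_likelihood (A : QueryAlgorithm d T Ξ) (ξ : Ξ) (k : ℕ)
    (hk : k ≤ T) {H : Matrix (Fin d) (Fin d) ℝ} (hH : H.IsSymm) :
    ∫⁻ g, likelihood (complProj k (nullTranscript A ξ k hk g)) H g ∂goeEntries d = 1 := by
  have h := lintegral_nullTranscript_add A ξ k hk hH (f := fun _ => 1) measurable_const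
  simpa using h.symm

/-- The exponent is linear in H up to a quadratic term, and polarizing that term leaves a
deterministic cross factor. -/
lemma likelihood_mul_likelihood (Q : Matrix (Fin d) (Fin d) ℝ) (H K : Matrix (Fin d) (Fin d) ℝ)
    (g : UpperIdx d → ℝ) :
    likelihood Q H g * likelihood Q K g = likelihood Q (H + K) g *
      ENNReal.ofReal (Real.exp (((H * K).trace - (Q * H * Q * (Q * K * Q)).trace) / 2)) := by
  unfold likelihood
  rw [← ENNReal.ofReal_mul (Real.exp_pos _).le, ← ENNReal.ofReal_mul (Real.exp_pos _).le,
    ← Real.exp_add, ← Real.exp_add]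
  congr 2
  have h : (Q * K * Q * (Q * H * Q)).trace = (Q * H * Q * (Q * K * Q)).trace :=
    Matrix.trace_mul_comm _ _
  simp only [mul_add, add_mul, sub_mul, Matrix.trace_add, Matrix.trace_sub, h,
    Matrix.trace_mul_comm K H]
  ring

end Likelihood

/-! ### Rank-one shifts and their overlap with the queries -/

section Spike

variable {d : ℕ}

/-- The shift of the noise that corresponds to the spike `lam θ θᵀ`. -/
def spike (lam : ℝ) (θ : Vec d) : Matrix (Fin d) (Fin d) ℝ :=
  (Real.sqrt d * lam) • vecMulVec θ.ofLp θ.ofLp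

lemma isSymm_spike (lam : ℝ) (θ : Vec d) : (spike lam θ).IsSymm := by
  refine Matrix.IsSymm.smul ?_ _
  unfold Matrix.IsSymm
  rw [Matrix.transpose_vecMulVec]

lemma measurable_spike (lam : ℝ) (i j : Fin d) : Measurable fun θ : Vec d => spike lam θ i j := by
  simp only [spike, Matrix.smul_apply, Matrix.vecMulVec_apply, smul_eq_mul]
  fun_prop

lemma spikedMatrix_eq (hd : 0 < d) (lam : ℝ) (θ : Vec d) (g : UpperIdx d → ℝ) :
    spikedMatrix lam θ g = nullMatrix (g + upperPart (spike lam θ)) := by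
  have h : Real.sqrt d ≠ 0 := (Real.sqrt_pos.2 (by exact_mod_cast hd)).ne'
  rw [nullMatrix, symmMatrix_add, symmMatrix_upperPart (isSymm_spike lam θ), spikedMatrix, spike,
    smul_add, smul_smul, add_comm]
  congr 2
  field_simp

/-- Squared length of the component of `θ` orthogonal to the range of `Q`. -/
def overlap (Q : Matrix (Fin d) (Fin d) ℝ) (θ : Vec d) : ℝ :=
  (θ.ofLp - Q *ᵥ θ.ofLp) ⬝ᵥ (θ.ofLp - Q *ᵥ θ.ofLp)

lemma measurable_overlap {X : Type*} [MeasurableSpace X] {Q : X → Matrix (Fin d) (Fin d) ℝ}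
    {θ : X → Vec d} (hQ : ∀ i j, Measurable fun x => Q x i j) (hθ : Measurable θ) :
    Measurable fun x => overlap (Q x) (θ x) := by
  have h := measurable_mulVec_apply hQ ((WithLp.measurable_ofLp 2 _).comp hθ)
  simp only [Function.comp_apply] at h
  simp only [overlap, dotProduct, Pi.sub_apply]
  fun_prop

lemma overlap_one (θ : Vec d) : overlap 1 θ = 0 := by
  simp [overlap]

/-- The unit vector in the direction of `Q v`, or `0` if `Q v = 0`. -/
def newDirection (Q : Matrix (Fin d) (Fin d) ℝ) (v : Vec d) : Vec d :=
  WithLp.toLp 2 ((Real.sqrt ((Q *ᵥ v.ofLp) ⬝ᵥ (Q *ᵥ v.ofLp)))⁻¹ • (Q *ᵥ v.ofLp))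

lemma inner_eq_dotProduct (u v : Vec d) : inner ℝ u v = u.ofLp ⬝ᵥ v.ofLp := by
  rw [EuclideanSpace.inner_eq_star_dotProduct, dotProduct_comm]
  simp

lemma dotProduct_self_nonneg' (y : Fin d → ℝ) : 0 ≤ y ⬝ᵥ y :=
  Finset.sum_nonneg fun _ _ => mul_self_nonneg _

lemma norm_newDirection_le (Q : Matrix (Fin d) (Fin d) ℝ) (v : Vec d) :
    ‖newDirection Q v‖ ≤ 1 := by
  have h : ‖newDirection Q v‖ ^ 2 ≤ 1 := by
    rw [← real_inner_self_eq_norm_sq, inner_eq_dotProduct, newDirection]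
    simp only [smul_dotProduct, dotProduct_smul, smul_eq_mul]
    set y := Q *ᵥ v.ofLp
    rw [← mul_assoc, ← mul_inv, Real.mul_self_sqrt (dotProduct_self_nonneg' y)]
    exact inv_mul_le_one
  exact (sq_le_one_iff₀ (norm_nonneg _)).1 h

lemma measurable_newDirection {X : Type*} [MeasurableSpace X] {Q : X → Matrix (Fin d) (Fin d) ℝ}
    {v : X → Vec d} (hQ : ∀ i j, Measurable fun x => Q x i j) (hv : Measurable v) :
    Measurable fun x => newDirection (Q x) (v x) := by
  have h := measurable_mulVec_apply hQ ((WithLp.measurable_ofLp 2 _).comp hv)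
  simp only [Function.comp_apply] at h
  refine (WithLp.measurable_toLp 2 _).comp (measurable_pi_lambda _ fun i => ?_)
  simp only [Pi.smul_apply, smul_eq_mul, dotProduct]
  fun_prop

lemma IsOrthProj.overlap_eq {Q : Matrix (Fin d) (Fin d) ℝ} (hQ : IsOrthProj Q) (θ : Vec d) :
    overlap Q θ = θ.ofLp ⬝ᵥ θ.ofLp - θ.ofLp ⬝ᵥ (Q *ᵥ θ.ofLp) := by
  rw [overlap, sub_dotProduct, dotProduct_sub, dotProduct_sub, hQ.dotProduct_mulVec,
    dotProduct_comm (Q *ᵥ θ.ofLp)]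
  ring

/-- Pythagoras: this additivity drives the induction over rounds. -/
lemma IsOrthProj.overlap_deflate {Q : Matrix (Fin d) (Fin d) ℝ} (hQ : IsOrthProj Q)
    (v θ : Vec d) :
    overlap (SpikedQuery.deflate Q v.ofLp) θ =
      overlap Q θ + (inner ℝ (newDirection Q v) θ) ^ 2 := by
  rw [(hQ.deflate v.ofLp).overlap_eq, hQ.overlap_eq, inner_eq_dotProduct, newDirection,
    SpikedQuery.deflate]
  set y := Q *ᵥ v.ofLp
  rw [smul_dotProduct, smul_eq_mul, mul_pow, inv_pow,
    Real.sq_sqrt (dotProduct_self_nonneg' y), Matrix.sub_mulVec, dotProduct_sub,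
    Matrix.smul_mulVec, Matrix.vecMulVec_mulVec, dotProduct_smul, op_smul_eq_smul,
    dotProduct_smul, smul_eq_mul, smul_eq_mul, dotProduct_comm θ.ofLp y]
  ring

lemma IsOrthProj.conj_vecMulVec {Q : Matrix (Fin d) (Fin d) ℝ} (hQ : IsOrthProj Q)
    (θ : Fin d → ℝ) : Q * vecMulVec θ θ * Q = vecMulVec (Q *ᵥ θ) (Q *ᵥ θ) := by
  rw [Matrix.mul_vecMulVec, Matrix.vecMulVec_mul, hQ.vecMul_eq]

lemma trace_vecMulVec_mul_vecMulVec (x y : Fin d → ℝ) :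
    (vecMulVec x x * vecMulVec y y).trace = (x ⬝ᵥ y) ^ 2 := by
  rw [Matrix.vecMulVec_mul_vecMulVec, Matrix.trace_vecMulVec, dotProduct_smul, smul_eq_mul]
  ring

/-- The information that the observed part of the noise carries about both of two spikes. -/
lemma IsOrthProj.cross_le {Q : Matrix (Fin d) (Fin d) ℝ} (hQ : IsOrthProj Q) (lam : ℝ)
    {θ θ' : Vec d} {R : ℝ} (h : overlap Q θ ≤ R) (h' : overlap Q θ' ≤ R) :
    ((spike lam θ * spike lam θ').trace -
      (Q * spike lam θ * Q * (Q * spike lam θ' * Q)).trace) / 2 ≤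
      d * lam ^ 2 * R * |inner ℝ θ θ'| := by
  have h1 : (spike lam θ * spike lam θ').trace = d * lam ^ 2 * (θ.ofLp ⬝ᵥ θ'.ofLp) ^ 2 := by
    rw [spike, spike, Matrix.smul_mul, Matrix.mul_smul, Matrix.trace_smul, Matrix.trace_smul,
      trace_vecMulVec_mul_vecMulVec, smul_eq_mul, smul_eq_mul, ← mul_assoc]
    congr 1
    rw [mul_mul_mul_comm, Real.mul_self_sqrt (Nat.cast_nonneg d)]
    ring
  have h2 : (Q * spike lam θ * Q * (Q * spike lam θ' * Q)).trace =
      d * lam ^ 2 * ((Q *ᵥ θ.ofLp) ⬝ᵥ (Q *ᵥ θ'.ofLp)) ^ 2 := by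
    simp only [spike, Matrix.mul_smul, Matrix.smul_mul]
    rw [hQ.conj_vecMulVec, hQ.conj_vecMulVec, Matrix.trace_smul, Matrix.trace_smul,
      trace_vecMulVec_mul_vecMulVec, smul_eq_mul, smul_eq_mul, ← mul_assoc]
    congr 1
    rw [mul_mul_mul_comm, Real.mul_self_sqrt (Nat.cast_nonneg d)]
    ring
  rw [h1, h2, inner_eq_dotProduct]
  set a := θ.ofLp ⬝ᵥ θ'.ofLp
  set x := θ.ofLp - Q *ᵥ θ.ofLp with hx
  set y := θ'.ofLp - Q *ᵥ θ'.ofLp with hy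
  have hb : (Q *ᵥ θ.ofLp) ⬝ᵥ (Q *ᵥ θ'.ofLp) = a - x ⬝ᵥ y := by
    have e1 := hQ.dotProduct_mulVec θ.ofLp θ'.ofLp
    have e2 := hQ.dotProduct_mulVec θ'.ofLp θ.ofLp
    rw [dotProduct_comm (Q *ᵥ θ'.ofLp), dotProduct_comm θ'.ofLp] at e2
    rw [hx, hy, sub_dotProduct, dotProduct_sub, dotProduct_sub]
    linarith
  have hxR : x ⬝ᵥ x ≤ R := h
  have hyR : y ⬝ᵥ y ≤ R := h'
  have hp := dotProduct_self_nonneg' (x + y)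
  have hm := dotProduct_self_nonneg' (x - y)
  simp only [add_dotProduct, dotProduct_add, dotProduct_comm y x] at hp
  simp only [sub_dotProduct, dotProduct_sub, dotProduct_comm y x] at hm
  -- Cauchy–Schwarz in its weak form |x·y| ≤ (|x|² + |y|²)/2.
  have hab : |x ⬝ᵥ y| ≤ R := abs_le.2 ⟨by linarith, by linarith⟩
  rw [hb]
  have hd : (0 : ℝ) ≤ d * lam ^ 2 := by positivity
  have key : (a ^ 2 - (a - x ⬝ᵥ y) ^ 2) / 2 ≤ R * |a| := by
    have h3 : a * (x ⬝ᵥ y) ≤ R * |a| := by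
      calc a * (x ⬝ᵥ y) ≤ |a * (x ⬝ᵥ y)| := le_abs_self _
        _ = |x ⬝ᵥ y| * |a| := by rw [abs_mul, mul_comm]
        _ ≤ R * |a| := by gcongr
    -- With c = x·y, the left side is ac − c²/2, and the negative square is dropped.
    nlinarith [sq_nonneg (x ⬝ᵥ y)]
  nlinarith [mul_le_mul_of_nonneg_left key hd]

lemma IsOrthProj.likelihood_mul_le {Q : Matrix (Fin d) (Fin d) ℝ} (hQ : IsOrthProj Q) (lam : ℝ)
    {θ θ' : Vec d} {R : ℝ} (h : overlap Q θ ≤ R) (h' : overlap Q θ' ≤ R)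
    (g : UpperIdx d → ℝ) :
    likelihood Q (spike lam θ) g * likelihood Q (spike lam θ') g ≤
      likelihood Q (spike lam θ + spike lam θ') g *
        ENNReal.ofReal (Real.exp (d * lam ^ 2 * R * |inner ℝ θ θ'|)) := by
  rw [likelihood_mul_likelihood]
  gcongr
  exact hQ.cross_le lam h h'

end Spike

/-! ### Concentration of linear functionals on the sphere, by comparison with a Gaussian -/

section Sphere

lemma lintegral_eq_lintegral_toSphere {E : Type*} [NormedAddCommGroup E] [NormedSpace ℝ E]
    [FiniteDimensional ℝ E] [Nontrivial E] [MeasurableSpace E] [BorelSpace E] (μ : Measure E)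
    [μ.IsAddHaarMeasure] {f : E → ℝ≥0∞} (hf : Measurable f) :
    ∫⁻ x, f x ∂μ = ∫⁻ θ : Metric.sphere (0 : E) 1, ∫⁻ r : Set.Ioi (0 : ℝ), f (r.1 • θ.1)
      ∂Measure.volumeIoiPow (Module.finrank ℝ E - 1) ∂μ.toSphere := by
  have h := (μ.measurePreserving_homeomorphUnitSphereProd).symm
    (homeomorphUnitSphereProd E).toMeasurableEquiv
  have hm : Measurable fun p : Metric.sphere (0 : E) 1 × Set.Ioi (0 : ℝ) =>
      f (p.2.1 • p.1.1) := by fun_prop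
  rw [← lintegral_prod (fun p : Metric.sphere (0 : E) 1 × Set.Ioi (0 : ℝ) =>
    f (p.2.1 • p.1.1)) hm.aemeasurable]
  have h0 : ∫⁻ x, f x ∂μ = ∫⁻ x : ({0}ᶜ : Set E), f x.1 ∂μ.comap Subtype.val := by
    rw [lintegral_subtype_comap (measurableSet_singleton (0 : E)).compl,
      restrict_compl_singleton]
  rw [h0, ← h.lintegral_comp (f := fun x : ({0}ᶜ : Set E) => f x.1)
    (hf.comp measurable_subtype_coe)]
  refine lintegral_congr fun p => ?_
  simp

lemma lintegral_volumeIoiPow_exp {n : ℕ} (hn : 0 < n) {b : ℝ} (hb : 0 < b) :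
    ∫⁻ r : Set.Ioi (0 : ℝ), ENNReal.ofReal (Real.exp (-b * r.1 ^ 2))
      ∂Measure.volumeIoiPow (n - 1) =
      ENNReal.ofReal (b ^ (-(n / 2 : ℝ)) * (1 / 2 * Real.Gamma (n / 2))) := by
  rw [Measure.volumeIoiPow, lintegral_withDensity_eq_lintegral_mul _ (by fun_prop) (by fun_prop)]
  simp only [Pi.mul_apply]
  rw [lintegral_subtype_comap measurableSet_Ioi (f := fun r : ℝ =>
    ENNReal.ofReal (r ^ (n - 1)) * ENNReal.ofReal (Real.exp (-b * r ^ 2)))]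
  have hn1 : ((n - 1 : ℕ) : ℝ) = n - 1 := by rw [Nat.cast_sub hn]; simp
  have hn0 : (0 : ℝ) < n := by exact_mod_cast hn
  have h := integral_rpow_mul_exp_neg_mul_rpow (p := 2) (q := (n - 1 : ℕ)) (b := b) two_pos
    (by rw [hn1]; linarith) hb
  have hi : IntegrableOn (fun x : ℝ => x ^ ((n - 1 : ℕ) : ℝ) * Real.exp (-b * x ^ (2 : ℝ)))
      (Set.Ioi 0) :=
    integrableOn_rpow_mul_exp_neg_mul_rpow (by rw [hn1]; linarith) (by norm_num) hb
  rw [hn1] at h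
  have he : (n - 1 + 1 : ℝ) = n := by ring
  rw [he, mul_assoc, neg_div] at h
  rw [← h, ofReal_integral_eq_lintegral_ofReal (by rw [← hn1]; exact hi)
    (by
      filter_upwards [ae_restrict_mem measurableSet_Ioi] with x hx
      have : (0 : ℝ) < x := hx
      positivity)]
  refine setLIntegral_congr_fun measurableSet_Ioi fun x hx => ?_
  have hx0 : (0 : ℝ) < x := hx
  rw [← ENNReal.ofReal_mul (by positivity), ← hn1, Real.rpow_natCast, Real.rpow_two]

lemma lintegral_exp_sq_gaussianReal :
    ∫⁻ z, ENNReal.ofReal (Real.exp (z ^ 2 / 4)) ∂gaussianReal 0 1 =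
      ENNReal.ofReal (Real.sqrt 2) := by
  rw [gaussianReal_of_var_ne_zero _ one_ne_zero,
    lintegral_withDensity_eq_lintegral_mul _ (measurable_gaussianPDF _ _) (by fun_prop)]
  have h : ∀ z, (gaussianPDF 0 1 * fun z => ENNReal.ofReal (Real.exp (z ^ 2 / 4))) z =
      ENNReal.ofReal ((Real.sqrt (2 * Real.pi))⁻¹ * Real.exp (-(1 / 4) * z ^ 2)) := by
    intro z
    simp only [Pi.mul_apply, gaussianPDF, gaussianPDFReal, NNReal.coe_one, mul_one, sub_zero]
    rw [← ENNReal.ofReal_mul (by positivity), mul_assoc, ← Real.exp_add]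
    congr 3
    ring
  simp_rw [h]
  rw [← ofReal_integral_eq_lintegral_ofReal
    ((integrable_exp_neg_mul_sq (by norm_num)).const_mul _)
    (Filter.Eventually.of_forall fun z => by positivity), integral_const_mul, integral_gaussian,
    ← Real.sqrt_inv, ← Real.sqrt_mul (by positivity)]
  congr 2
  have := Real.pi_pos
  field_simp
  norm_num

variable {d : ℕ}

/-- Translation by w completes the square. -/
lemma lintegral_exp_neg_norm_sq_add_inner (w : Vec d) :
    ∫⁻ x : Vec d, ENNReal.ofReal (Real.exp (-(1 / 2) * ‖x‖ ^ 2 + inner ℝ w x)) =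
      (∫⁻ x : Vec d, ENNReal.ofReal (Real.exp (-(1 / 2) * ‖x‖ ^ 2))) *
        ENNReal.ofReal (Real.exp (‖w‖ ^ 2 / 2)) := by
  rw [← lintegral_mul_const' _ _ ENNReal.ofReal_ne_top, ← lintegral_add_right_eq_self _ w]
  refine lintegral_congr fun x => ?_
  rw [← ENNReal.ofReal_mul (Real.exp_pos _).le, ← Real.exp_add, norm_add_sq_real,
    inner_add_right, real_inner_self_eq_norm_sq, real_inner_comm w x]
  ring_nf

/-- The square is linearized by an auxiliary Gaussian z: exp(a²/4) is the mean of exp(az/√2).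
Integrating x first then leaves at most the mean of exp(z²/4), which is √2. -/
lemma lintegral_exp_neg_norm_sq_add_inner_sq_le {u : Vec d} (hu : ‖u‖ ≤ 1) :
    ∫⁻ x : Vec d, ENNReal.ofReal (Real.exp (-(1 / 2) * ‖x‖ ^ 2 + (inner ℝ u x) ^ 2 / 4)) ≤
      (∫⁻ x : Vec d, ENNReal.ofReal (Real.exp (-(1 / 2) * ‖x‖ ^ 2))) *
        ENNReal.ofReal (Real.sqrt 2) := by
  have h1 : ∀ x : Vec d,
      ENNReal.ofReal (Real.exp (-(1 / 2) * ‖x‖ ^ 2 + (inner ℝ u x) ^ 2 / 4)) =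
        ∫⁻ z, ENNReal.ofReal (Real.exp (-(1 / 2) * ‖x‖ ^ 2 +
          inner ℝ ((z / Real.sqrt 2) • u) x)) ∂gaussianReal 0 1 := by
    intro x
    have h := mgf_id_gaussianReal (μ := 0) (v := 1)
    have h' := congrFun h (inner ℝ u x / Real.sqrt 2)
    simp only [mgf, id, zero_mul, NNReal.coe_one, one_mul, zero_add, div_pow, Real.sq_sqrt
      (zero_le_two : (0 : ℝ) ≤ 2)] at h'
    have h2 : ∀ z : ℝ, ENNReal.ofReal (Real.exp (-(1 / 2) * ‖x‖ ^ 2 +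
        inner ℝ ((z / Real.sqrt 2) • u) x)) = ENNReal.ofReal (Real.exp (-(1 / 2) * ‖x‖ ^ 2)) *
          ENNReal.ofReal (Real.exp (inner ℝ u x / Real.sqrt 2 * z)) := by
      intro z
      rw [← ENNReal.ofReal_mul (Real.exp_pos _).le, ← Real.exp_add, real_inner_smul_left]
      ring_nf
    simp_rw [h2]
    rw [lintegral_const_mul' _ _ ENNReal.ofReal_ne_top, ← ofReal_integral_eq_lintegral_ofReal
      (integrable_exp_mul_gaussianReal _)
      (Filter.Eventually.of_forall fun z => (Real.exp_pos _).le), h',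
      ← ENNReal.ofReal_mul (Real.exp_pos _).le, ← Real.exp_add]
    ring_nf
  simp_rw [h1]
  rw [lintegral_lintegral_swap (by fun_prop)]
  simp_rw [lintegral_exp_neg_norm_sq_add_inner]
  rw [lintegral_const_mul _ (by fun_prop), ← lintegral_exp_sq_gaussianReal]
  refine mul_le_mul_right (lintegral_mono fun z => ENNReal.ofReal_le_ofReal
    (Real.exp_le_exp.2 ?_)) _
  rw [norm_smul, mul_pow, Real.norm_eq_abs, sq_abs, div_pow, Real.sq_sqrt zero_le_two]
  have : ‖u‖ ^ 2 ≤ 1 := pow_le_one₀ (norm_nonneg _) hu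
  nlinarith [sq_nonneg z]

/-- Sub-Gaussian estimate for a coordinate of a uniformly distributed unit vector. -/
lemma lintegral_exp_inner_sq_uniformSphere_le (hd : 0 < d) {u : Vec d} (hu : ‖u‖ ≤ 1) :
    ∫⁻ θ, ENNReal.ofReal (Real.exp (d * (inner ℝ u θ) ^ 2 / 4)) ∂uniformSphere d ≤
      ENNReal.ofReal (Real.sqrt 2) := by
  have : Nonempty (Fin d) := ⟨⟨0, hd⟩⟩
  have : Nontrivial (Vec d) := inferInstance
  set σ := (volume : Measure (Vec d)).toSphere with hσ
  set K : ℝ := (1 / 2 : ℝ) ^ (-(d / 2 : ℝ)) * (1 / 2 * Real.Gamma (d / 2)) with hK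
  have hd0 : (0 : ℝ) < d := by exact_mod_cast hd
  have hKpos : 0 < K := by
    have := Real.Gamma_pos_of_pos (half_pos hd0)
    positivity
  set J := ∫⁻ x : Vec d, ENNReal.ofReal (Real.exp (-(1 / 2) * ‖x‖ ^ 2)) with hJ
  have hrank : Module.finrank ℝ (Vec d) = d := by simp
  have hJσ : J = σ Set.univ * ENNReal.ofReal K := by
    rw [hJ, lintegral_eq_lintegral_toSphere _ (by fun_prop), hrank]
    have : ∀ θ : Metric.sphere (0 : Vec d) 1, ∫⁻ r : Set.Ioi (0 : ℝ),
        ENNReal.ofReal (Real.exp (-(1 / 2) * ‖r.1 • θ.1‖ ^ 2)) ∂Measure.volumeIoiPow (d - 1) =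
          ENNReal.ofReal K := by
      intro θ
      rw [hK, ← lintegral_volumeIoiPow_exp hd (by norm_num)]
      simp [norm_smul]
    simp_rw [this]
    rw [lintegral_const, mul_comm]
  -- In polar coordinates the Gaussian integral with the extra square has radial part K(1 −
  -- t/2)^(-d/2) in direction θ, with t = ⟨u,θ⟩². This is at least K exp(dt/4), so the Gaussian
  -- bound passes to the sphere.
  have hlow : (∫⁻ θ : Metric.sphere (0 : Vec d) 1,
      ENNReal.ofReal (Real.exp (d * (inner ℝ u θ.1) ^ 2 / 4)) ∂σ) * ENNReal.ofReal K ≤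
      J * ENNReal.ofReal (Real.sqrt 2) := by
    refine le_trans ?_ (lintegral_exp_neg_norm_sq_add_inner_sq_le hu)
    rw [lintegral_eq_lintegral_toSphere (volume : Measure (Vec d)) (by fun_prop), hrank,
      ← lintegral_mul_const' _ _ ENNReal.ofReal_ne_top]
    refine lintegral_mono fun θ => ?_
    set t := (inner ℝ u θ.1) ^ 2 with ht
    have hθ : ‖θ.1‖ = 1 := by simp
    have ht1 : t ≤ 1 := by
      have h := abs_real_inner_le_norm u θ.1
      rw [hθ, mul_one] at h
      rw [ht, ← sq_abs]
      exact pow_le_one₀ (abs_nonneg _) (h.trans hu)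
    have ht0 : 0 ≤ t := sq_nonneg _
    have hr : ∀ r : Set.Ioi (0 : ℝ), ENNReal.ofReal (Real.exp (-(1 / 2) * ‖r.1 • θ.1‖ ^ 2 +
        (inner ℝ u (r.1 • θ.1)) ^ 2 / 4)) =
        ENNReal.ofReal (Real.exp (-(1 / 2 - t / 4) * r.1 ^ 2)) := by
      intro r
      rw [norm_smul, hθ, mul_one, real_inner_smul_right, mul_pow, ← ht, Real.norm_eq_abs, sq_abs]
      ring_nf
    simp_rw [hr]
    rw [lintegral_volumeIoiPow_exp hd (by linarith), ← ENNReal.ofReal_mul (Real.exp_pos _).le]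
    refine ENNReal.ofReal_le_ofReal ?_
    rw [hK, ← mul_assoc]
    have hG := Real.Gamma_pos_of_pos (half_pos hd0)
    gcongr
    have hsplit : (1 / 2 - t / 4 : ℝ) = (1 - t / 2) * (1 / 2) := by ring
    rw [hsplit, Real.mul_rpow (by linarith) (by norm_num)]
    gcongr
    calc Real.exp (d * t / 4) = (Real.exp (-(t / 2))) ^ (-(d / 2 : ℝ)) := by
          rw [← Real.exp_mul]; ring_nf
      _ ≤ (1 - t / 2) ^ (-(d / 2 : ℝ)) := by
          refine Real.rpow_le_rpow_of_nonpos (by linarith) ?_ (by linarith)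
          linarith [Real.add_one_le_exp (-(t / 2))]
  have hσ0 : σ Set.univ ≠ 0 := by
    rw [Ne, Measure.measure_univ_eq_zero]
    exact Measure.toSphere_ne_zero _
  have hσtop : σ Set.univ ≠ ∞ := measure_ne_top _ _
  have hK0 : ENNReal.ofReal K ≠ 0 := by simpa using hKpos
  rw [uniformSphere, lintegral_map (by fun_prop) measurable_subtype_coe,
    lintegral_smul_measure, smul_eq_mul]
  rw [hJσ, mul_right_comm] at hlow
  have := (ENNReal.mul_le_mul_iff_left hK0 ENNReal.ofReal_ne_top).1 hlow
  calc _ ≤ (σ Set.univ)⁻¹ * (σ Set.univ * ENNReal.ofReal (Real.sqrt 2)) := by gcongr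
    _ = _ := by rw [← mul_assoc, ENNReal.inv_mul_cancel hσ0 hσtop, one_mul]

lemma ae_norm_eq_one_uniformSphere (d : ℕ) : ∀ᵐ θ ∂uniformSphere d, ‖θ‖ = 1 := by
  rw [uniformSphere, ae_map_iff measurable_subtype_coe.aemeasurable
    (measurableSet_eq_fun measurable_norm measurable_const)]
  exact Filter.Eventually.of_forall fun θ => by simp

/-- Gaussian tail bound for a coordinate of a uniformly distributed unit vector. -/
lemma uniformSphere_tail_le (hd : 0 < d) {u : Vec d} (hu : ‖u‖ ≤ 1) (τ : ℝ) :
    uniformSphere d {θ | τ < (inner ℝ u θ) ^ 2} ≤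
      ENNReal.ofReal (Real.sqrt 2 * Real.exp (-(d * τ / 4))) := by
  have hm : MeasurableSet {θ : Vec d | τ < (inner ℝ u θ) ^ 2} :=
    measurableSet_lt measurable_const (by fun_prop)
  rw [← lintegral_indicator_one hm]
  calc _ ≤ ∫⁻ θ, ENNReal.ofReal (Real.exp (d * (inner ℝ u θ) ^ 2 / 4)) *
        ENNReal.ofReal (Real.exp (-(d * τ / 4))) ∂uniformSphere d := by
        refine lintegral_mono fun θ => ?_
        by_cases hθ : θ ∈ {θ : Vec d | τ < (inner ℝ u θ) ^ 2}
        · rw [Set.indicator_of_mem hθ, ← ENNReal.ofReal_mul (Real.exp_pos _).le, ← Real.exp_add,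
            Pi.one_apply, ← ENNReal.ofReal_one]
          refine ENNReal.ofReal_le_ofReal (Real.one_le_exp ?_)
          have h1 : τ ≤ (inner ℝ u θ) ^ 2 := le_of_lt hθ
          have h2 : (0 : ℝ) ≤ d := Nat.cast_nonneg d
          nlinarith
        · rw [Set.indicator_of_notMem hθ]
          exact zero_le
    _ ≤ _ := by
        rw [lintegral_mul_const' _ _ ENNReal.ofReal_ne_top,
          ENNReal.ofReal_mul (Real.sqrt_nonneg _)]
        gcongr
        exact lintegral_exp_inner_sq_uniformSphere_le hd hu

/-- Exponential moments of the inner product of a uniformly distributed unit vector with a vector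
of norm at most one. -/
lemma lintegral_exp_abs_inner_uniformSphere_le (hd : 0 < d) {u : Vec d} (hu : ‖u‖ ≤ 1) {κ : ℝ}
    (hκ : 0 ≤ κ) (hκd : κ ≤ Real.sqrt d) :
    ∫⁻ θ, ENNReal.ofReal (Real.exp (κ * |inner ℝ u θ|)) ∂uniformSphere d ≤
      ENNReal.ofReal (1 + 4 * (κ / Real.sqrt d)) := by
  have := isProbabilityMeasure_uniformSphere hd
  have hd0 : (0 : ℝ) < d := by exact_mod_cast hd
  have hs : 0 < Real.sqrt d := Real.sqrt_pos.2 hd0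
  set t := κ / Real.sqrt d with ht
  have ht0 : 0 ≤ t := by positivity
  have ht1 : t ≤ 1 := (div_le_one hs).2 hκd
  have hpt : ∀ θ : Vec d, ENNReal.ofReal (Real.exp (κ * |inner ℝ u θ|)) ≤
      ENNReal.ofReal (1 - t) + ENNReal.ofReal (t * Real.exp 1) *
        ENNReal.ofReal (Real.exp (d * (inner ℝ u θ) ^ 2 / 4)) := by
    intro θ
    rw [← ENNReal.ofReal_mul (by positivity), ← ENNReal.ofReal_add (by linarith) (by positivity)]
    refine ENNReal.ofReal_le_ofReal ?_
    set s := Real.sqrt d * |inner ℝ u θ| with hsdef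
    -- The exponent is a convex combination of 0 and s with weight t. Convexity of exp makes the
    -- excess over 1 linear in t = κ/√d.
    have h1 : κ * |inner ℝ u θ| = (1 - t) * 0 + t * s := by
      rw [ht, hsdef]; field_simp; ring
    have h2 := convexOn_exp.2 (Set.mem_univ 0) (Set.mem_univ s) (sub_nonneg.2 ht1) ht0
      (sub_add_cancel 1 t)
    simp only [smul_eq_mul, Real.exp_zero, mul_one] at h2
    have h3 : (d : ℝ) * (inner ℝ u θ) ^ 2 / 4 = s ^ 2 / 4 := by
      rw [hsdef, mul_pow, Real.sq_sqrt hd0.le, sq_abs]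
    rw [h1, h3]
    refine h2.trans ?_
    rw [mul_assoc, ← Real.exp_add]
    gcongr
    -- This is s ≤ 1 + s²/4, which reduces exp(s) to the sub-Gaussian moment.
    nlinarith [sq_nonneg (s / 2 - 1)]
  calc _ ≤ ∫⁻ θ, (ENNReal.ofReal (1 - t) + ENNReal.ofReal (t * Real.exp 1) *
        ENNReal.ofReal (Real.exp (d * (inner ℝ u θ) ^ 2 / 4))) ∂uniformSphere d :=
        lintegral_mono hpt
    _ ≤ ENNReal.ofReal (1 - t) + ENNReal.ofReal (t * Real.exp 1) *
        ENNReal.ofReal (Real.sqrt 2) := by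
        rw [lintegral_add_left measurable_const, lintegral_const, measure_univ, mul_one,
          lintegral_const_mul' _ _ ENNReal.ofReal_ne_top]
        gcongr
        exact lintegral_exp_inner_sq_uniformSphere_le hd hu
    _ ≤ _ := by
        rw [← ENNReal.ofReal_mul (by positivity),
          ← ENNReal.ofReal_add (by linarith) (by positivity)]
        refine ENNReal.ofReal_le_ofReal ?_
        have h2 : Real.sqrt 2 ≤ 3 / 2 := Real.sqrt_le_iff.2 ⟨by norm_num, by norm_num⟩
        have h3 := Real.exp_one_lt_d9
        have h4 : Real.exp 1 * Real.sqrt 2 ≤ 5 := by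
          calc Real.exp 1 * Real.sqrt 2 ≤ 2.8 * (3 / 2) := by gcongr; linarith
            _ ≤ 5 := by norm_num
        nlinarith [mul_le_mul_of_nonneg_left h4 ht0]

end Sphere

/-! ### Growth of the overlap under the mixture -/

section SecondMoment

attribute [local irreducible] likelihood overlap complProj nullTranscript

variable {d T : ℕ} {Ξ : Type*} [MeasurableSpace Ξ]

lemma measurable_complProj_nullTranscript (A : QueryAlgorithm d T Ξ) (ξ : Ξ) (k : ℕ) (hk : k ≤ T)
    (i j : Fin d) : Measurable fun g => complProj k (nullTranscript A ξ k hk g) i j :=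
  (measurable_complProj k i j).comp (measurable_nullTranscript A ξ k hk)

lemma measurable_overlap_complProj (k : ℕ) :
    Measurable fun p : Vec d × (Fin k → Vec d × Vec d) => overlap (complProj k p.2) p.1 :=
  measurable_overlap (fun i j => (measurable_complProj k i j).comp measurable_snd) measurable_fst

/-- Indicator that the first `k` queries have squared overlap larger than `R` with `θ`. -/
def exceeds (k : ℕ) (R : ℝ) (θ : Vec d) (z : Fin k → Vec d × Vec d) : ℝ≥0∞ :=
  if R < overlap (complProj k z) θ then 1 else 0

/-- Indicator that the first `k` queries have squared overlap at most `R` with `θ`. -/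
def within (k : ℕ) (R : ℝ) (θ : Vec d) (z : Fin k → Vec d × Vec d) : ℝ≥0∞ :=
  if overlap (complProj k z) θ ≤ R then 1 else 0

lemma within_add_exceeds (k : ℕ) (R : ℝ) (θ : Vec d) (z : Fin k → Vec d × Vec d) :
    within k R θ z + exceeds k R θ z = 1 := by
  unfold within exceeds
  rcases le_or_gt (overlap (complProj k z) θ) R with h | h
  · simp [h, h.not_gt]
  · simp [h, h.not_ge]

lemma measurable_exceeds (k : ℕ) (R : ℝ) :
    Measurable fun p : Vec d × (Fin k → Vec d × Vec d) => exceeds k R p.1 p.2 :=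
  Measurable.ite (measurableSet_lt measurable_const (measurable_overlap_complProj k))
    measurable_const measurable_const

lemma measurable_within (k : ℕ) (R : ℝ) :
    Measurable fun p : Vec d × (Fin k → Vec d × Vec d) => within k R p.1 p.2 :=
  Measurable.ite (measurableSet_le (measurable_overlap_complProj k) measurable_const)
    measurable_const measurable_const

/-- The likelihood ratio of the first `k` rounds. -/
def roundLikelihood (A : QueryAlgorithm d T Ξ) (ξ : Ξ) (lam : ℝ) (k : ℕ) (hk : k ≤ T)
    (θ : Vec d) (g : UpperIdx d → ℝ) : ℝ≥0∞ :=
  likelihood (complProj k (nullTranscript A ξ k hk g)) (spike lam θ) g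

lemma measurable_roundLikelihood (A : QueryAlgorithm d T Ξ) (ξ : Ξ) (lam : ℝ) (k : ℕ)
    (hk : k ≤ T) : Measurable fun p : Vec d × (UpperIdx d → ℝ) =>
      roundLikelihood A ξ lam k hk p.1 p.2 :=
  measurable_likelihood
    (fun i j => (measurable_complProj_nullTranscript A ξ k hk i j).comp measurable_snd)
    (fun i j => (measurable_spike lam i j).comp measurable_fst) measurable_snd

/-- Probability, under the mixture, that the first `k` queries have squared overlap larger than `R`
with the spike. -/
def exceedMass (A : QueryAlgorithm d T Ξ) (ξ : Ξ) (lam : ℝ) (k : ℕ) (hk : k ≤ T) (R : ℝ) :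
    ℝ≥0∞ :=
  ∫⁻ θ, ∫⁻ g, exceeds k R θ (nullTranscript A ξ k hk g) * likelihood 0 (spike lam θ) g
    ∂goeEntries d ∂uniformSphere d

lemma exceedMass_zero (A : QueryAlgorithm d T Ξ) (ξ : Ξ) (lam : ℝ) {R : ℝ} (hR : 0 ≤ R) :
    exceedMass A ξ lam 0 (Nat.zero_le T) R = 0 := by
  simp [exceedMass, exceeds, complProj, overlap_one, hR.not_gt]

lemma measurable_likelihood_spike (lam : ℝ) : Measurable fun p : Vec d × (UpperIdx d → ℝ) =>
    likelihood 0 (spike lam p.1) p.2 :=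
  measurable_likelihood (Q := fun _ => 0) (fun _ _ => measurable_const)
    (fun i j => (measurable_spike lam i j).comp measurable_fst) measurable_snd

lemma measurable_comp_nullTranscript (A : QueryAlgorithm d T Ξ) (ξ : Ξ) (k : ℕ) (hk : k ≤ T)
    {f : Vec d → (Fin k → Vec d × Vec d) → ℝ≥0∞}
    (hf : Measurable fun p : Vec d × (Fin k → Vec d × Vec d) => f p.1 p.2) :
    Measurable fun p : Vec d × (UpperIdx d → ℝ) => f p.1 (nullTranscript A ξ k hk p.2) :=
  hf.comp (measurable_fst.prodMk ((measurable_nullTranscript A ξ k hk).comp measurable_snd))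

/-- Weighted AM–GM, playing the role of Cauchy–Schwarz: s trades the second moment of a likelihood
ratio against a null probability. -/
lemma le_weighted_sq (x : ℝ≥0∞) {s : ℝ} (hs : 0 < s) :
    x ≤ ENNReal.ofReal (s / 2) * (x * x) + ENNReal.ofReal (1 / (2 * s)) := by
  by_cases hx : x = ∞
  · have : ENNReal.ofReal (s / 2) ≠ 0 := by simpa using hs
    rw [hx, ENNReal.top_mul_top, ENNReal.mul_top this]
    simp
  rw [← ENNReal.ofReal_toReal hx]
  have hx0 : 0 ≤ x.toReal := ENNReal.toReal_nonneg
  generalize x.toReal = y at hx0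
  rw [← ENNReal.ofReal_mul hx0, ← ENNReal.ofReal_mul (by positivity),
    ← ENNReal.ofReal_add (by positivity) (by positivity)]
  refine ENNReal.ofReal_le_ofReal ?_
  have h : s / 2 * (y * y) + 1 / (2 * s) - y = (s * y - 1) ^ 2 / (2 * s) := by
    field_simp
    ring
  have : 0 ≤ (s * y - 1) ^ 2 / (2 * s) := by positivity
  linarith

/-- The direction u depends on the noise only, not on θ; after exchanging the integrals it is a
fixed vector. -/
lemma lintegral_inner_sq_gt_le (hd : 0 < d) (τ : ℝ) {u : (UpperIdx d → ℝ) → Vec d} (hu : Measurable u)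
    (hu1 : ∀ g, ‖u g‖ ≤ 1) :
    ∫⁻ θ, ∫⁻ g, (if τ < (inner ℝ (u g) θ) ^ 2 then 1 else 0) ∂goeEntries d ∂uniformSphere d ≤
      ENNReal.ofReal (Real.sqrt 2 * Real.exp (-(d * τ / 4))) := by
  have := isProbabilityMeasure_uniformSphere hd
  have hm : Measurable fun p : Vec d × (UpperIdx d → ℝ) =>
      (if τ < (inner ℝ (u p.2) p.1) ^ 2 then (1 : ℝ≥0∞) else 0) :=
    Measurable.ite (measurableSet_lt measurable_const (by fun_prop)) measurable_const
      measurable_const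
  rw [lintegral_lintegral_swap hm.aemeasurable]
  calc _ ≤ ∫⁻ _ : UpperIdx d → ℝ, ENNReal.ofReal (Real.sqrt 2 * Real.exp (-(d * τ / 4)))
        ∂goeEntries d := by
        refine lintegral_mono fun g => ?_
        refine le_trans (le_of_eq ?_) (uniformSphere_tail_le hd (hu1 g) τ)
        have hs : MeasurableSet {θ : Vec d | τ < (inner ℝ (u g) θ) ^ 2} :=
          measurableSet_lt measurable_const (by fun_prop)
        rw [← lintegral_indicator_one hs]
        refine lintegral_congr fun θ => ?_
        simp [Set.indicator_apply]
    _ = _ := by simp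

/-- The direction that query `k` adds to the span of the previous ones. -/
def queryDirection (A : QueryAlgorithm d T Ξ) (ξ : Ξ) {k : ℕ} (hk : k + 1 ≤ T)
    (z : Fin k → Vec d × Vec d) : Vec d :=
  newDirection (complProj k z) (nextQuery A ξ hk z)

lemma measurable_queryDirection (A : QueryAlgorithm d T Ξ) (ξ : Ξ) {k : ℕ} (hk : k + 1 ≤ T) :
    Measurable (queryDirection A ξ hk) :=
  measurable_newDirection (measurable_complProj k) (measurable_nextQuery A ξ hk)

/-- Indicator that the first `k` queries have squared overlap at most `R` with `θ`, while the next
one has squared overlap larger than `τ`. -/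
def jumps (A : QueryAlgorithm d T Ξ) (ξ : Ξ) {k : ℕ} (hk : k + 1 ≤ T) (R τ : ℝ) (θ : Vec d)
    (z : Fin k → Vec d × Vec d) : ℝ≥0∞ :=
  within k R θ z * (if τ < (inner ℝ (queryDirection A ξ hk z) θ) ^ 2 then 1 else 0)

lemma measurable_jumps (A : QueryAlgorithm d T Ξ) (ξ : Ξ) {k : ℕ} (hk : k + 1 ≤ T) (R τ : ℝ) :
    Measurable fun p : Vec d × (Fin k → Vec d × Vec d) => jumps A ξ hk R τ p.1 p.2 := by
  have h := (measurable_queryDirection A ξ hk).comp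
    (measurable_snd : Measurable fun p : Vec d × (Fin k → Vec d × Vec d) => p.2)
  exact (measurable_within k R).mul (Measurable.ite (measurableSet_lt measurable_const
    ((h.inner measurable_fst).pow_const 2)) measurable_const measurable_const)

/-- To pass R + τ, the overlap must already be above R or gain more than τ in one round. -/
lemma exceeds_succ_le (A : QueryAlgorithm d T Ξ) (ξ : Ξ) {k : ℕ} (hk : k + 1 ≤ T) (R τ : ℝ)
    (θ : Vec d) (g : UpperIdx d → ℝ) :
    exceeds (k + 1) (R + τ) θ (nullTranscript A ξ (k + 1) hk g) ≤
      exceeds k R θ (nullTranscript A ξ k (Nat.le_of_succ_le hk) g) +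
        jumps A ξ hk R τ θ (nullTranscript A ξ k (Nat.le_of_succ_le hk) g) := by
  have h1 : overlap (complProj (k + 1) (nullTranscript A ξ (k + 1) hk g)) θ =
      overlap (complProj k (nullTranscript A ξ k (Nat.le_of_succ_le hk) g)) θ +
        (inner ℝ (queryDirection A ξ hk
          (nullTranscript A ξ k (Nat.le_of_succ_le hk) g)) θ) ^ 2 := by
    rw [nullTranscript_succ, complProj_snoc, (isOrthProj_complProj k _).overlap_deflate,
      queryDirection]
  simp only [exceeds, jumps, within, h1]
  generalize overlap (complProj k (nullTranscript A ξ k (Nat.le_of_succ_le hk) g)) θ = a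
  generalize (inner ℝ (queryDirection A ξ hk
    (nullTranscript A ξ k (Nat.le_of_succ_le hk) g)) θ) ^ 2 = b
  by_cases h2 : R < a
  · simp only [h2, if_true]
    exact le_add_right (by split_ifs <;> simp)
  · by_cases h3 : τ < b
    · simp only [h2, not_lt.1 h2, h3, if_true, if_false, zero_add, mul_one]
      split_ifs <;> simp
    · have : ¬ R + τ < a + b := by linarith
      simp [this]

/-- A jump is decided by the first k rounds, so only their likelihood ratio enters. Its second
moment is controlled because a jump requires the overlap to have been at most R. -/
lemma lintegral_jumps_mul_likelihood_le (A : QueryAlgorithm d T Ξ) (ξ : Ξ) (lam : ℝ)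
    {k : ℕ} (hk : k + 1 ≤ T) (R τ : ℝ) {s : ℝ} (hs : 0 < s) {θ : Vec d} (hθ : ‖θ‖ = 1) :
    ∫⁻ g, jumps A ξ hk R τ θ (nullTranscript A ξ k (Nat.le_of_succ_le hk) g) *
        likelihood 0 (spike lam θ) g ∂goeEntries d ≤
      ENNReal.ofReal (s / 2) * ENNReal.ofReal (Real.exp (d * lam ^ 2 * R)) +
        ENNReal.ofReal (1 / (2 * s)) *
          ∫⁻ g, (if τ < (inner ℝ (queryDirection A ξ hk
            (nullTranscript A ξ k (Nat.le_of_succ_le hk) g)) θ) ^ 2 then 1 else 0)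
            ∂goeEntries d := by
  have hk' := Nat.le_of_succ_le hk
  have hdir := (measurable_queryDirection A ξ hk).comp (measurable_nullTranscript A ξ k hk')
  have hind : Measurable fun g => (if τ < (inner ℝ (queryDirection A ξ hk
      (nullTranscript A ξ k hk' g)) θ) ^ 2 then (1 : ℝ≥0∞) else 0) :=
    Measurable.ite (measurableSet_lt measurable_const
      ((hdir.inner measurable_const).pow_const 2)) measurable_const measurable_const
  have hsym : (spike lam θ + spike lam θ).IsSymm :=
    (isSymm_spike lam θ).add (isSymm_spike lam θ)
  have hjm : Measurable (jumps A ξ hk R τ θ) :=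
    (measurable_jumps A ξ hk R τ).comp (measurable_prodMk_left (x := θ))
  rw [lintegral_nullTranscript_mul_likelihood_zero A ξ k hk' (isSymm_spike lam θ) hjm]
  calc _ ≤ ∫⁻ g, (ENNReal.ofReal (s / 2) * ENNReal.ofReal (Real.exp (d * lam ^ 2 * R)) *
        likelihood (complProj k (nullTranscript A ξ k hk' g)) (spike lam θ + spike lam θ) g +
        ENNReal.ofReal (1 / (2 * s)) * (if τ < (inner ℝ (queryDirection A ξ hk
          (nullTranscript A ξ k hk' g)) θ) ^ 2 then 1 else 0)) ∂goeEntries d := by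
        refine lintegral_mono fun g => ?_
        simp only [jumps, within]
        by_cases h2 : overlap (complProj k (nullTranscript A ξ k hk' g)) θ ≤ R
        · by_cases h3 : τ < (inner ℝ (queryDirection A ξ hk (nullTranscript A ξ k hk' g)) θ) ^ 2
          · simp only [h2, h3, if_true, mul_one, one_mul]
            refine (le_weighted_sq _ hs).trans (add_le_add_left ?_ _)
            have h4 := (isOrthProj_complProj k (nullTranscript A ξ k hk' g)).likelihood_mul_le
              lam h2 h2 g
            rw [real_inner_self_eq_norm_sq, hθ] at h4
            simp only [one_pow, abs_one, mul_one] at h4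
            rw [mul_assoc (ENNReal.ofReal (s / 2)),
              mul_comm (ENNReal.ofReal (Real.exp (d * lam ^ 2 * R)))]
            exact mul_le_mul_right h4 _
          · simp [h3]
        · simp [h2]
    _ = _ := by
        rw [lintegral_add_right _ (hind.const_mul _),
          lintegral_const_mul' _ _ (by finiteness), lintegral_const_mul' _ _ (by finiteness),
          lintegral_likelihood A ξ k hk' hsym, mul_one]

lemma exceedMass_succ_le (hd : 0 < d) (A : QueryAlgorithm d T Ξ) (ξ : Ξ) (lam : ℝ) {k : ℕ}
    (hk : k + 1 ≤ T) (R τ : ℝ) {s : ℝ} (hs : 0 < s) :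
    exceedMass A ξ lam (k + 1) hk (R + τ) ≤
      exceedMass A ξ lam k (Nat.le_of_succ_le hk) R +
        ENNReal.ofReal (s / 2 * Real.exp (d * lam ^ 2 * R) +
          1 / (2 * s) * (Real.sqrt 2 * Real.exp (-(d * τ / 4)))) := by
  have := isProbabilityMeasure_uniformSphere hd
  have hk' := Nat.le_of_succ_le hk
  have hdir := (measurable_queryDirection A ξ hk).comp (measurable_nullTranscript A ξ k hk')
  have hEm : Measurable fun p : Vec d × (UpperIdx d → ℝ) =>
      exceeds k R p.1 (nullTranscript A ξ k hk' p.2) * likelihood 0 (spike lam p.1) p.2 :=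
    (measurable_comp_nullTranscript A ξ k hk' (measurable_exceeds (d := d) k R)).mul
      (measurable_likelihood_spike lam)
  calc exceedMass A ξ lam (k + 1) hk (R + τ)
      ≤ ∫⁻ θ, (∫⁻ g, exceeds k R θ (nullTranscript A ξ k hk' g) *
          likelihood 0 (spike lam θ) g ∂goeEntries d +
          ∫⁻ g, jumps A ξ hk R τ θ (nullTranscript A ξ k hk' g) *
            likelihood 0 (spike lam θ) g ∂goeEntries d) ∂uniformSphere d := by
        refine lintegral_mono fun θ => ?_
        have hm : Measurable fun g => exceeds k R θ (nullTranscript A ξ k hk' g) *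
            likelihood 0 (spike lam θ) g := hEm.comp (measurable_prodMk_left (x := θ))
        rw [← lintegral_add_left hm]
        refine lintegral_mono fun g => ?_
        simp only [← add_mul]
        exact mul_le_mul_left (exceeds_succ_le A ξ hk R τ θ g) _
    _ = exceedMass A ξ lam k hk' R + ∫⁻ θ, ∫⁻ g, jumps A ξ hk R τ θ
          (nullTranscript A ξ k hk' g) * likelihood 0 (spike lam θ) g
          ∂goeEntries d ∂uniformSphere d :=
        lintegral_add_left (Measurable.lintegral_prod_right' hEm) _
    _ ≤ exceedMass A ξ lam k hk' R + ∫⁻ θ, (ENNReal.ofReal (s / 2) *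
          ENNReal.ofReal (Real.exp (d * lam ^ 2 * R)) + ENNReal.ofReal (1 / (2 * s)) *
            ∫⁻ g, (if τ < (inner ℝ (queryDirection A ξ hk (nullTranscript A ξ k hk' g)) θ) ^ 2
              then 1 else 0) ∂goeEntries d) ∂uniformSphere d := by
        refine add_le_add_right (lintegral_mono_ae ?_) _
        filter_upwards [ae_norm_eq_one_uniformSphere d] with θ hθ
        exact lintegral_jumps_mul_likelihood_le A ξ lam hk R τ hs hθ
    _ ≤ _ := by
        refine add_le_add_right ?_ _
        rw [lintegral_add_left measurable_const, lintegral_const, measure_univ, mul_one,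
          lintegral_const_mul' _ _ ENNReal.ofReal_ne_top,
          ENNReal.ofReal_add (by positivity) (by positivity),
          ENNReal.ofReal_mul (by positivity), ENNReal.ofReal_mul (p := 1 / (2 * s)) (by positivity)]
        exact add_le_add_right (mul_le_mul_right (lintegral_inner_sq_gt_le hd τ hdir
          fun g => norm_newDirection_le _ _) _) _

/-- The level that the squared overlap of `k` queries with the spike is unlikely to exceed. -/
def overlapLevel (d : ℕ) (lam l : ℝ) (k : ℕ) : ℝ := 16 * l / (d * lam ^ 2) * (5 * lam ^ 2) ^ k

lemma overlapLevel_nonneg (d : ℕ) (lam : ℝ) {l : ℝ} (hl : 0 ≤ l) (k : ℕ) :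
    0 ≤ overlapLevel d lam l k := by
  unfold overlapLevel; positivity

lemma exceedMass_overlapLevel_le (hd : 0 < d) (A : QueryAlgorithm d T Ξ) (ξ : Ξ) {lam l : ℝ}
    (hlam : 2 < lam) (hl : 0 ≤ l) (k : ℕ) (hk : k ≤ T) :
    exceedMass A ξ lam k hk (overlapLevel d lam l k) ≤
      ENNReal.ofReal (k * (Real.sqrt 2 * Real.exp (-l))) := by
  induction k with
  | zero => simp [exceedMass_zero A ξ lam (overlapLevel_nonneg d lam hl 0)]
  | succ k ih =>
    set R := overlapLevel d lam l k with hR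
    have hd0 : (0 : ℝ) < d := by exact_mod_cast hd
    have hlam2 : 4 < lam ^ 2 := by nlinarith
    have hR1 : overlapLevel d lam l (k + 1) = R + (5 * lam ^ 2 - 1) * R := by
      rw [hR, overlapLevel, overlapLevel, pow_succ]; ring
    have hRl : 16 * l ≤ d * lam ^ 2 * R := by
      have h1 : (1 : ℝ) ≤ (5 * lam ^ 2) ^ k := one_le_pow₀ (by linarith)
      have h2 : (d : ℝ) * lam ^ 2 * R = 16 * l * (5 * lam ^ 2) ^ k := by
        rw [hR, overlapLevel]; field_simp
      rw [h2]
      nlinarith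
    have hR0 : 0 ≤ R := overlapLevel_nonneg d lam hl k
    set cap := d * lam ^ 2 * R with hcap
    -- This fixes the constants of `overlapLevel`: the factor 5 makes dτ/4 about 5/4 `cap`, with a
    -- correction dR/4 ≤ `cap`/16 since λ² > 4, and the 16 gives `cap` ≥ 16l.
    have hτ : 2 * l + cap ≤ d * ((5 * lam ^ 2 - 1) * R) / 4 := by
      have h1 : 4 * (d * R) ≤ cap := by
        rw [hcap]; nlinarith [mul_nonneg hd0.le hR0]
      have h2 : d * ((5 * lam ^ 2 - 1) * R) / 4 = 5 / 4 * cap - d * R / 4 := by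
        rw [hcap]; ring
      rw [h2]
      linarith
    rw [hR1]
    -- The weight s = exp(−l − `cap`) makes the second-moment term exp(−l)/2, and `hτ` makes the
    -- tail term at most √2 exp(−l)/2.
    refine (exceedMass_succ_le hd A ξ lam hk R _ (Real.exp_pos (-l - cap))).trans ?_
    have h2 : Real.exp (-l - cap) / 2 * Real.exp (d * lam ^ 2 * R) +
        1 / (2 * Real.exp (-l - cap)) * (Real.sqrt 2 *
          Real.exp (-(d * ((5 * lam ^ 2 - 1) * R) / 4))) ≤ Real.sqrt 2 * Real.exp (-l) := by
      have e1 : Real.exp (-l - cap) / 2 * Real.exp (d * lam ^ 2 * R) = Real.exp (-l) / 2 := by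
        rw [div_mul_eq_mul_div, ← Real.exp_add, ← hcap, sub_add_cancel]
      have e2 : 1 / (2 * Real.exp (-l - cap)) * (Real.sqrt 2 *
          Real.exp (-(d * ((5 * lam ^ 2 - 1) * R) / 4))) =
          Real.sqrt 2 / 2 * Real.exp (l + cap - d * ((5 * lam ^ 2 - 1) * R) / 4) := by
        rw [one_div, mul_inv, ← Real.exp_neg, sub_eq_add_neg (l + cap), Real.exp_add (l + cap),
          show -(-l - cap) = l + cap by ring]
        ring
      have e3 : Real.exp (l + cap - d * ((5 * lam ^ 2 - 1) * R) / 4) ≤ Real.exp (-l) :=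
        Real.exp_le_exp.2 (by linarith)
      have e4 : 1 ≤ Real.sqrt 2 := Real.one_le_sqrt.2 (by norm_num)
      rw [e1, e2]
      nlinarith [Real.exp_pos (-l)]
    calc _ ≤ ENNReal.ofReal (k * (Real.sqrt 2 * Real.exp (-l))) +
          ENNReal.ofReal (Real.sqrt 2 * Real.exp (-l)) := by
          gcongr
          exact ih _
      _ = _ := by
          rw [← ENNReal.ofReal_add (by positivity) (by positivity)]
          congr 1
          push_cast
          ring

/-! ### Truncated second moment and comparison with the null model -/

/-- The truncated likelihood ratio of the mixture and the null model. -/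
def truncatedLikelihood (A : QueryAlgorithm d T Ξ) (ξ : Ξ) (lam R : ℝ) (g : UpperIdx d → ℝ) :
    ℝ≥0∞ :=
  ∫⁻ θ, within T R θ (nullTranscript A ξ T le_rfl g) * roundLikelihood A ξ lam T le_rfl θ g
    ∂uniformSphere d

lemma measurable_within_mul_roundLikelihood (A : QueryAlgorithm d T Ξ) (ξ : Ξ) (lam R : ℝ) :
    Measurable fun p : Vec d × (UpperIdx d → ℝ) =>
      within T R p.1 (nullTranscript A ξ T le_rfl p.2) * roundLikelihood A ξ lam T le_rfl p.1 p.2 :=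
  (measurable_comp_nullTranscript A ξ T le_rfl (measurable_within (d := d) T R)).mul
    (measurable_roundLikelihood A ξ lam T le_rfl)

lemma measurable_truncatedLikelihood (hd : 0 < d) (A : QueryAlgorithm d T Ξ) (ξ : Ξ)
    (lam R : ℝ) : Measurable (truncatedLikelihood A ξ lam R) := by
  have := isProbabilityMeasure_uniformSphere hd
  exact Measurable.lintegral_prod_left' (measurable_within_mul_roundLikelihood A ξ lam R)

/-- Truncation removes only the exceedance mass from a likelihood ratio of integral one. -/
lemma one_le_lintegral_truncatedLikelihood_add (hd : 0 < d) (A : QueryAlgorithm d T Ξ) (ξ : Ξ)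
    (lam R : ℝ) :
    1 ≤ ∫⁻ g, truncatedLikelihood A ξ lam R g ∂goeEntries d + exceedMass A ξ lam T le_rfl R := by
  have := isProbabilityMeasure_uniformSphere hd
  have hm := measurable_within_mul_roundLikelihood A ξ lam R
  unfold truncatedLikelihood
  rw [lintegral_lintegral_swap (by exact (hm.comp measurable_swap).aemeasurable), exceedMass,
    ← lintegral_add_left (Measurable.lintegral_prod_right' hm)]
  refine le_of_eq ?_
  have h : ∀ θ : Vec d, ∫⁻ g, within T R θ (nullTranscript A ξ T le_rfl g) *
      roundLikelihood A ξ lam T le_rfl θ g ∂goeEntries d +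
      ∫⁻ g, exceeds T R θ (nullTranscript A ξ T le_rfl g) * likelihood 0 (spike lam θ) g
        ∂goeEntries d = 1 := by
    intro θ
    have hs := isSymm_spike lam θ
    have hm' : Measurable fun g => within T R θ (nullTranscript A ξ T le_rfl g) *
        roundLikelihood A ξ lam T le_rfl θ g := hm.comp (measurable_prodMk_left (x := θ))
    have he : Measurable (exceeds T R θ) := (measurable_exceeds T R).comp (measurable_prodMk_left (x := θ))
    rw [lintegral_nullTranscript_mul_likelihood_zero A ξ T le_rfl hs he,
      ← lintegral_add_left hm']
    simp only [roundLikelihood, ← add_mul, within_add_exceeds, one_mul]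
    exact lintegral_likelihood A ξ T le_rfl hs
  simp [h]

lemma lintegral_within_mul_within_le (A : QueryAlgorithm d T Ξ) (ξ : Ξ) (lam R : ℝ)
    (θ θ' : Vec d) :
    ∫⁻ g, (within T R θ (nullTranscript A ξ T le_rfl g) * roundLikelihood A ξ lam T le_rfl θ g) *
        (within T R θ' (nullTranscript A ξ T le_rfl g) * roundLikelihood A ξ lam T le_rfl θ' g)
        ∂goeEntries d ≤
      ENNReal.ofReal (Real.exp (d * lam ^ 2 * R * |inner ℝ θ θ'|)) := by
  have hsym := (isSymm_spike lam θ).add (isSymm_spike lam θ')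
  calc _ ≤ ∫⁻ g, likelihood (complProj T (nullTranscript A ξ T le_rfl g))
          (spike lam θ + spike lam θ') g *
          ENNReal.ofReal (Real.exp (d * lam ^ 2 * R * |inner ℝ θ θ'|)) ∂goeEntries d := by
        refine lintegral_mono fun g => ?_
        simp only [within, roundLikelihood]
        by_cases h1 : overlap (complProj T (nullTranscript A ξ T le_rfl g)) θ ≤ R
        · by_cases h2 : overlap (complProj T (nullTranscript A ξ T le_rfl g)) θ' ≤ R
          · simp only [h1, h2, if_true, one_mul]
            exact (isOrthProj_complProj T _).likelihood_mul_le lam h1 h2 g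
          · simp [h2]
        · simp [h1]
    _ = _ := by
        rw [lintegral_mul_const' _ _ ENNReal.ofReal_ne_top,
          lintegral_likelihood A ξ T le_rfl hsym, one_mul]

lemma lintegral_truncatedLikelihood_sq_le (hd : 0 < d) (A : QueryAlgorithm d T Ξ) (ξ : Ξ)
    (lam : ℝ) {R : ℝ} (hR : 0 ≤ R) (hκ : d * lam ^ 2 * R ≤ Real.sqrt d) :
    ∫⁻ g, truncatedLikelihood A ξ lam R g * truncatedLikelihood A ξ lam R g ∂goeEntries d ≤
      ENNReal.ofReal (1 + 4 * (d * lam ^ 2 * R / Real.sqrt d)) := by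
  have := isProbabilityMeasure_uniformSphere hd
  have hm := measurable_within_mul_roundLikelihood A ξ lam R
  have hsq : ∀ g, truncatedLikelihood A ξ lam R g * truncatedLikelihood A ξ lam R g =
      ∫⁻ p : Vec d × Vec d, (within T R p.1 (nullTranscript A ξ T le_rfl g) *
          roundLikelihood A ξ lam T le_rfl p.1 g) *
        (within T R p.2 (nullTranscript A ξ T le_rfl g) *
          roundLikelihood A ξ lam T le_rfl p.2 g) ∂(uniformSphere d).prod (uniformSphere d) := by
    intro g
    have hg : AEMeasurable (fun θ => within T R θ (nullTranscript A ξ T le_rfl g) *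
        roundLikelihood A ξ lam T le_rfl θ g) (uniformSphere d) :=
      (hm.comp (measurable_prodMk_right (y := g))).aemeasurable
    exact (lintegral_prod_mul hg hg).symm
  have hm2 : Measurable fun q : (UpperIdx d → ℝ) × (Vec d × Vec d) =>
      (within T R q.2.1 (nullTranscript A ξ T le_rfl q.1) *
          roundLikelihood A ξ lam T le_rfl q.2.1 q.1) *
        (within T R q.2.2 (nullTranscript A ξ T le_rfl q.1) *
          roundLikelihood A ξ lam T le_rfl q.2.2 q.1) :=
    (hm.comp (measurable_snd.fst.prodMk measurable_fst)).mul
      (hm.comp (measurable_snd.snd.prodMk measurable_fst))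
  calc _ = ∫⁻ p : Vec d × Vec d, ∫⁻ g, (within T R p.1 (nullTranscript A ξ T le_rfl g) *
          roundLikelihood A ξ lam T le_rfl p.1 g) *
        (within T R p.2 (nullTranscript A ξ T le_rfl g) *
          roundLikelihood A ξ lam T le_rfl p.2 g)
        ∂goeEntries d ∂(uniformSphere d).prod (uniformSphere d) := by
        rw [lintegral_congr hsq]
        exact lintegral_lintegral_swap hm2.aemeasurable
    _ ≤ ∫⁻ p : Vec d × Vec d, ENNReal.ofReal (Real.exp (d * lam ^ 2 * R * |inner ℝ p.1 p.2|))
        ∂(uniformSphere d).prod (uniformSphere d) :=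
        lintegral_mono fun p => lintegral_within_mul_within_le A ξ lam R p.1 p.2
    _ = ∫⁻ θ, ∫⁻ θ', ENNReal.ofReal (Real.exp (d * lam ^ 2 * R * |inner ℝ θ θ'|))
        ∂uniformSphere d ∂uniformSphere d := lintegral_prod _ (by fun_prop)
    _ ≤ ∫⁻ _ : Vec d, ENNReal.ofReal (1 + 4 * (d * lam ^ 2 * R / Real.sqrt d))
        ∂uniformSphere d := by
        refine lintegral_mono_ae ?_
        filter_upwards [ae_norm_eq_one_uniformSphere d] with θ hθ
        exact lintegral_exp_abs_inner_uniformSphere_le hd hθ.le (by positivity) hκ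
    _ = _ := by simp

/-- The mean of (1 − Y)² is at most 2p + δ ≤ ε², and f(1 − Y) ≤ (1 − Y)²/(2ε) + εf²/2. All terms are
arranged without subtraction, because Y takes values in [0, ∞]. -/
lemma lintegral_le_of_second_moment {Ω : Type*} [MeasurableSpace Ω] {μ : Measure Ω}
    [IsProbabilityMeasure μ] {Y f : Ω → ℝ≥0∞} (hY : Measurable Y) (hf : Measurable f)
    (hf1 : ∀ ω, f ω ≤ 1) {p δ ε : ℝ} (hp : 0 ≤ p) (hδ : 0 ≤ δ) (hε : 0 < ε)
    (h1 : 1 ≤ ∫⁻ ω, Y ω ∂μ + ENNReal.ofReal p)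
    (h2 : ∫⁻ ω, Y ω * Y ω ∂μ ≤ ENNReal.ofReal (1 + δ)) (hεδ : 2 * p + δ ≤ ε ^ 2) :
    ∫⁻ ω, f ω ∂μ ≤ ∫⁻ ω, f ω * Y ω ∂μ + ENNReal.ofReal ε := by
  have hpt : ∀ ω, f ω + ENNReal.ofReal (1 / ε) * Y ω ≤
      f ω * Y ω + ENNReal.ofReal (1 / (2 * ε)) * (Y ω * Y ω) +
        ENNReal.ofReal (1 / (2 * ε) + ε / 2) := by
    intro ω
    have hfin : f ω ≠ ∞ := ne_top_of_le_ne_top ENNReal.one_ne_top (hf1 ω)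
    by_cases hYt : Y ω = ∞
    · have : ENNReal.ofReal (1 / (2 * ε)) ≠ 0 := by simpa using hε
      rw [hYt, ENNReal.top_mul_top, ENNReal.mul_top this]
      simp
    obtain ⟨a, ha⟩ : ∃ a : ℝ≥0, f ω = a := ⟨_, (ENNReal.coe_toNNReal hfin).symm⟩
    obtain ⟨y, hy⟩ : ∃ y : ℝ≥0, Y ω = y := ⟨_, (ENNReal.coe_toNNReal hYt).symm⟩
    have ha1 : (a : ℝ) ≤ 1 := by
      have := hf1 ω
      rw [ha] at this
      exact_mod_cast this
    rw [ha, hy, ← ENNReal.ofReal_coe_nnreal, ← ENNReal.ofReal_coe_nnreal,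
      ← ENNReal.ofReal_mul (by positivity), ← ENNReal.ofReal_mul (by positivity),
      ← ENNReal.ofReal_mul (by positivity), ← ENNReal.ofReal_mul (by positivity),
      ← ENNReal.ofReal_add (by positivity) (by positivity),
      ← ENNReal.ofReal_add (by positivity) (by positivity),
      ← ENNReal.ofReal_add (by positivity) (by positivity)]
    refine ENNReal.ofReal_le_ofReal ?_
    have e : (a : ℝ) * y + 1 / (2 * ε) * (y * y) + (1 / (2 * ε) + ε / 2) - (a + 1 / ε * y) =
        (1 / (2 * ε)) * ((1 - y) - a * ε) ^ 2 + ε / 2 * (1 - a ^ 2) := by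
      field_simp
      ring
    have h0 : (0 : ℝ) ≤ a := a.2
    have : (a : ℝ) ^ 2 ≤ 1 := pow_le_one₀ h0 ha1
    have : 0 ≤ (1 / (2 * ε)) * ((1 - y) - a * ε) ^ 2 + ε / 2 * (1 - (a : ℝ) ^ 2) := by
      have : 0 ≤ 1 - (a : ℝ) ^ 2 := by linarith
      positivity
    linarith
  have hint := lintegral_mono (μ := μ) hpt
  rw [lintegral_add_left hf, lintegral_const_mul' _ _ ENNReal.ofReal_ne_top,
    lintegral_add_right _ measurable_const,
    lintegral_add_left (f := fun ω => f ω * Y ω) (hf.mul hY),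
    lintegral_const_mul' _ _ ENNReal.ofReal_ne_top, lintegral_const, measure_univ, mul_one] at hint
  have h3 : ENNReal.ofReal (1 / ε) ≤ ENNReal.ofReal (1 / ε) * ∫⁻ ω, Y ω ∂μ +
      ENNReal.ofReal (p / ε) := by
    calc ENNReal.ofReal (1 / ε) = ENNReal.ofReal (1 / ε) * 1 := (mul_one _).symm
      _ ≤ ENNReal.ofReal (1 / ε) * (∫⁻ ω, Y ω ∂μ + ENNReal.ofReal p) := by gcongr
      _ = _ := by
        rw [mul_add, ← ENNReal.ofReal_mul (by positivity)]
        congr 2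
        ring
  have h4 : ENNReal.ofReal (1 / (2 * ε)) * ∫⁻ ω, Y ω * Y ω ∂μ ≤
      ENNReal.ofReal ((1 + δ) / (2 * ε)) := by
    calc _ ≤ ENNReal.ofReal (1 / (2 * ε)) * ENNReal.ofReal (1 + δ) := by gcongr
      _ = _ := by
        rw [← ENNReal.ofReal_mul (by positivity)]
        congr 1
        ring
  have h5 : ∫⁻ ω, f ω ∂μ + ENNReal.ofReal (1 / ε) ≤
      ∫⁻ ω, f ω * Y ω ∂μ + ENNReal.ofReal ε + ENNReal.ofReal (1 / ε) := by
    calc _ ≤ ∫⁻ ω, f ω ∂μ + (ENNReal.ofReal (1 / ε) * ∫⁻ ω, Y ω ∂μ +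
          ENNReal.ofReal (p / ε)) := by gcongr
      _ = (∫⁻ ω, f ω ∂μ + ENNReal.ofReal (1 / ε) * ∫⁻ ω, Y ω ∂μ) +
          ENNReal.ofReal (p / ε) := (add_assoc _ _ _).symm
      _ ≤ (∫⁻ ω, f ω * Y ω ∂μ + ENNReal.ofReal ((1 + δ) / (2 * ε)) +
          ENNReal.ofReal (1 / (2 * ε) + ε / 2)) + ENNReal.ofReal (p / ε) := by
          refine add_le_add_left (hint.trans ?_) _
          gcongr
      _ = ∫⁻ ω, f ω * Y ω ∂μ + ENNReal.ofReal ((1 + δ) / (2 * ε) +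
          (1 / (2 * ε) + ε / 2 + p / ε)) := by
          rw [add_assoc, add_assoc, ← ENNReal.ofReal_add (by positivity) (by positivity),
            ← ENNReal.ofReal_add (by positivity) (by positivity)]
      _ ≤ ∫⁻ ω, f ω * Y ω ∂μ + ENNReal.ofReal (ε + 1 / ε) := by
          refine add_le_add_right (ENNReal.ofReal_le_ofReal ?_) _
          have e : (1 + δ) / (2 * ε) + (1 / (2 * ε) + ε / 2 + p / ε) =
              1 / ε + (2 * p + δ + ε ^ 2) / (2 * ε) := by
            field_simp
            ring
          have e2 : (2 * p + δ + ε ^ 2) / (2 * ε) ≤ ε := by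
            rw [div_le_iff₀ (by positivity)]
            nlinarith
          linarith
      _ = _ := by
          rw [ENNReal.ofReal_add (by positivity) (by positivity), add_assoc]
  exact (ENNReal.add_le_add_iff_right ENNReal.ofReal_ne_top).1 h5

/-- Comparison of the null model with the mixture, for a fixed seed. -/
lemma lintegral_nullTranscript_le (hd : 0 < d) (A : QueryAlgorithm d T Ξ) (ξ : Ξ) (lam : ℝ)
    {R p ε : ℝ} (hR : 0 ≤ R) (hp : 0 ≤ p) (hε : 0 < ε) (hκ : d * lam ^ 2 * R ≤ Real.sqrt d)
    (hmass : exceedMass A ξ lam T le_rfl R ≤ ENNReal.ofReal p)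
    (hpε : 2 * p + 4 * (d * lam ^ 2 * R / Real.sqrt d) ≤ ε ^ 2)
    {f : (Fin T → Vec d × Vec d) → ℝ≥0∞} (hf : Measurable f) (hf1 : ∀ z, f z ≤ 1) :
    ∫⁻ g, f (nullTranscript A ξ T le_rfl g) ∂goeEntries d ≤
      ∫⁻ θ, ∫⁻ g, f (nullTranscript A ξ T le_rfl (g + upperPart (spike lam θ))) ∂goeEntries d
        ∂uniformSphere d + ENNReal.ofReal ε := by
  have := isProbabilityMeasure_uniformSphere hd
  have hfm := hf.comp (measurable_nullTranscript A ξ T le_rfl)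
  refine (lintegral_le_of_second_moment (measurable_truncatedLikelihood hd A ξ lam R) hfm
    (fun g => hf1 _) hp (by positivity) hε
    ((one_le_lintegral_truncatedLikelihood_add hd A ξ lam R).trans (by gcongr))
    (lintegral_truncatedLikelihood_sq_le hd A ξ lam hR hκ) hpε).trans ?_
  gcongr
  have hm := measurable_within_mul_roundLikelihood A ξ lam R
  have h1 : ∀ g, (f ∘ nullTranscript A ξ T le_rfl) g * truncatedLikelihood A ξ lam R g =
      ∫⁻ θ, f (nullTranscript A ξ T le_rfl g) * (within T R θ (nullTranscript A ξ T le_rfl g) *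
        roundLikelihood A ξ lam T le_rfl θ g) ∂uniformSphere d := fun g =>
    (lintegral_const_mul _ (hm.comp (measurable_prodMk_right (y := g)))).symm
  simp_rw [h1]
  rw [lintegral_lintegral_swap
    (by exact ((hfm.comp measurable_fst).mul (hm.comp measurable_swap)).aemeasurable)]
  refine lintegral_mono fun θ => ?_
  rw [lintegral_nullTranscript_add A ξ T le_rfl (isSymm_spike lam θ) hf]
  refine lintegral_mono fun g => ?_
  -- Dropping the truncation only increases the right side; this is why a one-sided comparison is
  -- made.
  have hw : within T R θ (nullTranscript A ξ T le_rfl g) ≤ 1 := by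
    unfold within; split_ifs <;> simp
  calc _ ≤ f (nullTranscript A ξ T le_rfl g) * (1 * roundLikelihood A ξ lam T le_rfl θ g) := by
        gcongr
    _ = _ := by rw [one_mul]; rfl

end SecondMoment

/-! ### Averaging over the seed and passage to total variation -/

section TotalVariation

variable {d T : ℕ} {Ξ : Type*} [MeasurableSpace Ξ]

lemma transcript_nullMatrix (A : QueryAlgorithm d T Ξ) (ξ : Ξ) (g : UpperIdx d → ℝ) :
    A.transcript (nullMatrix g) ξ = nullTranscript A ξ T le_rfl g := rfl

attribute [local irreducible] spikedMatrix QueryAlgorithm.transcript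

lemma transcriptLaw_apply (A : QueryAlgorithm d T Ξ) (ρ : Measure Ξ) [IsProbabilityMeasure ρ]
    (lam : ℝ) (θ : Vec d) {B : Set (Fin T → Vec d × Vec d)} (hB : MeasurableSet B) :
    transcriptLaw A ρ lam θ B = ∫⁻ ξ, ∫⁻ g, B.indicator 1 (A.transcript (spikedMatrix lam θ g) ξ)
      ∂goeEntries d ∂ρ := by
  have hm : Measurable fun p : (UpperIdx d → ℝ) × Ξ => A.transcript (spikedMatrix lam θ p.1) p.2 :=
    (measurable_transcript A lam).comp measurable_prodMk_left
  have hBm : Measurable (B.indicator (1 : (Fin T → Vec d × Vec d) → ℝ≥0∞)) :=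
    measurable_one.indicator hB
  rw [transcriptLaw, ← lintegral_indicator_one hB, lintegral_map hBm hm]
  exact lintegral_prod_symm _ (hBm.comp hm).aemeasurable

lemma mixtureLaw_apply (hd : 0 < d) (A : QueryAlgorithm d T Ξ) (ρ : Measure Ξ)
    [IsProbabilityMeasure ρ] (lam : ℝ) {B : Set (Fin T → Vec d × Vec d)} (hB : MeasurableSet B) :
    mixtureLaw A ρ lam B = ∫⁻ ξ, ∫⁻ θ, ∫⁻ g,
      B.indicator 1 (A.transcript (spikedMatrix lam θ g) ξ)
        ∂goeEntries d ∂uniformSphere d ∂ρ := by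
  have := isProbabilityMeasure_uniformSphere hd
  have hBm : Measurable (B.indicator (1 : (Fin T → Vec d × Vec d) → ℝ≥0∞)) :=
    measurable_one.indicator hB
  have h0 : Measurable fun p : Vec d × ((UpperIdx d → ℝ) × Ξ) =>
      B.indicator (1 : (Fin T → Vec d × Vec d) → ℝ≥0∞)
        (A.transcript (spikedMatrix lam p.1 p.2.1) p.2.2) :=
    hBm.comp (measurable_transcript A lam)
  have h1 : Measurable fun q : (Vec d × Ξ) × (UpperIdx d → ℝ) => (q.1.1, (q.2, q.1.2)) :=
    measurable_fst.fst.prodMk (measurable_snd.prodMk measurable_fst.snd)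
  have hm : Measurable fun p : Vec d × Ξ => ∫⁻ g, B.indicator
      (1 : (Fin T → Vec d × Vec d) → ℝ≥0∞) (A.transcript (spikedMatrix lam p.1 g) p.2)
        ∂goeEntries d :=
    Measurable.lintegral_prod_right' (h0.comp h1)
  rw [mixtureLaw, Measure.bind_apply hB (measurable_transcriptLaw A ρ lam).aemeasurable]
  simp_rw [transcriptLaw_apply A ρ lam _ hB]
  exact lintegral_lintegral_swap hm.aemeasurable

lemma transcriptLaw_zero_le (hd : 0 < d) (A : QueryAlgorithm d T Ξ) (ρ : Measure Ξ)
    [IsProbabilityMeasure ρ] {lam l ε : ℝ} (hlam : 2 < lam) (hl : 0 ≤ l) (hε : 0 < ε)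
    (hκ : d * lam ^ 2 * overlapLevel d lam l T ≤ Real.sqrt d)
    (hpε : 2 * (T * (Real.sqrt 2 * Real.exp (-l))) +
      4 * (d * lam ^ 2 * overlapLevel d lam l T / Real.sqrt d) ≤ ε ^ 2)
    {B : Set (Fin T → Vec d × Vec d)} (hB : MeasurableSet B) :
    transcriptLaw A ρ lam 0 B ≤ mixtureLaw A ρ lam B + ENNReal.ofReal ε := by
  rw [transcriptLaw_apply A ρ lam 0 hB, mixtureLaw_apply hd A ρ lam hB]
  have hBm : Measurable (B.indicator (1 : (Fin T → Vec d × Vec d) → ℝ≥0∞)) :=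
    measurable_one.indicator hB
  calc _ ≤ ∫⁻ ξ, (∫⁻ θ, ∫⁻ g, B.indicator 1 (A.transcript (spikedMatrix lam θ g) ξ)
        ∂goeEntries d ∂uniformSphere d + ENNReal.ofReal ε) ∂ρ := by
        refine lintegral_mono fun ξ => ?_
        have h := lintegral_nullTranscript_le hd A ξ lam (overlapLevel_nonneg d lam hl T)
          (by positivity) hε hκ (exceedMass_overlapLevel_le hd A ξ hlam hl T le_rfl) hpε hBm
          (fun z => Set.indicator_le_self' (fun _ _ => zero_le_one) z)
        simp_rw [spikedMatrix_zero, spikedMatrix_eq hd, transcript_nullMatrix]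
        exact h
    _ = _ := by
        rw [lintegral_add_right _ measurable_const, lintegral_const, measure_univ, mul_one]

/-- The bound for the complement of B is the reverse inequality for B, both total masses being one.
-/
lemma tvDist_le_of_forall_le {X : Type*} [MeasurableSpace X] (μ ν : Measure X)
    [IsProbabilityMeasure μ] [IsProbabilityMeasure ν] {ε : ℝ} (hε : 0 ≤ ε)
    (h : ∀ B, MeasurableSet B → μ B ≤ ν B + ENNReal.ofReal ε) : tvDist μ ν ≤ ε := by
  have h' : ∀ B, MeasurableSet B → μ.real B ≤ ν.real B + ε := by
    intro B hB
    have h1 := ENNReal.toReal_mono (by finiteness) (h B hB)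
    rwa [ENNReal.toReal_add (by finiteness) (by finiteness), ENNReal.toReal_ofReal hε] at h1
  have : Nonempty {B : Set X // MeasurableSet B} := ⟨⟨∅, MeasurableSet.empty⟩⟩
  refine ciSup_le fun ⟨B, hB⟩ => abs_le.2 ⟨?_, by linarith [h' B hB]⟩
  have h1 := h' Bᶜ hB.compl
  rw [probReal_compl_eq_one_sub hB, probReal_compl_eq_one_sub hB] at h1
  linarith

lemma tvDist_le_one {X : Type*} [MeasurableSpace X] (μ ν : Measure X)
    [IsProbabilityMeasure μ] [IsProbabilityMeasure ν] : tvDist μ ν ≤ 1 :=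
  tvDist_le_of_forall_le μ ν zero_le_one fun B _ => by
    rw [ENNReal.ofReal_one]
    exact prob_le_one.trans le_add_self

lemma tvDist_of_subsingleton {X : Type*} [MeasurableSpace X] [Subsingleton X] (μ ν : Measure X)
    [IsProbabilityMeasure μ] [IsProbabilityMeasure ν] : tvDist μ ν ≤ 0 :=
  tvDist_le_of_forall_le μ ν le_rfl fun B _ => by
    rcases B.eq_empty_or_nonempty with rfl | h
    · simp
    · rw [Subsingleton.eq_univ_of_nonempty h]
      simp

end TotalVariation

/-! ### Choice of the constants -/

section Numerics

/-- The truncation level is compatible with the claimed bound whenever that bound is nontrivial. -/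
lemma numeric_bound {d T : ℕ} (hd : 0 < d) (hT : T ≠ 0) {lam ε : ℝ} (hlam : 2 < lam)
    (hε : ε = Real.sqrt 2 * (40 * lam) ^ T / (d : ℝ) ^ (1 / 4 : ℝ) *
      (Real.sqrt (Real.log ((d : ℝ) / (40 * lam) ^ T)) + 4)) (hε1 : ε < 1) :
    0 < ε ∧ d * lam ^ 2 * overlapLevel d lam (Real.log d) T ≤ Real.sqrt d ∧
      2 * (T * (Real.sqrt 2 * Real.exp (-Real.log d))) +
        4 * (d * lam ^ 2 * overlapLevel d lam (Real.log d) T / Real.sqrt d) ≤ ε ^ 2 := by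
  have hd1 : (1 : ℝ) ≤ d := by exact_mod_cast hd
  have hd0 : (0 : ℝ) < d := by linarith
  set q := (d : ℝ) ^ (1 / 4 : ℝ) with hq
  have hq0 : 0 < q := Real.rpow_pos_of_pos hd0 _
  have hq2 : q ^ 2 = Real.sqrt d := by
    rw [hq, ← Real.rpow_natCast, ← Real.rpow_mul hd0.le, Real.sqrt_eq_rpow]
    norm_num
  have hs0 : 0 < Real.sqrt d := Real.sqrt_pos.2 hd0
  have hsd : Real.sqrt d ≤ d := by
    rw [Real.sqrt_le_left hd0.le]; nlinarith
  set l := Real.log d with hl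
  have hl0 : 0 ≤ l := Real.log_nonneg hd1
  set P := (40 * lam) ^ T with hP
  have hP1 : 1 ≤ P := one_le_pow₀ (by linarith)
  have hP0 : 0 < P := by linarith
  set x := P / q with hx
  have hx0 : 0 < x := by positivity
  set S := Real.sqrt (Real.log (d / P)) with hS
  have hS0 : 0 ≤ S := Real.sqrt_nonneg _
  have h2 : Real.sqrt 2 ^ 2 = 2 := Real.sq_sqrt zero_le_two
  have hεx : ε = Real.sqrt 2 * x * (S + 4) := by rw [hε, hx]; ring
  have h20 : 1 ≤ Real.sqrt 2 := Real.one_le_sqrt.2 (by norm_num)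
  have hεpos : 0 < ε := by rw [hεx]; positivity
  have hε2 : ε ^ 2 = 2 * x ^ 2 * (S + 4) ^ 2 := by rw [hεx, mul_pow, mul_pow, h2]
  have hε2lt : ε ^ 2 < 1 := pow_lt_one₀ hεpos.le hε1 two_ne_zero
  -- the nontrivial regime
  have hx1 : x < 1 := by
    refine lt_of_le_of_lt ?_ hε1
    calc x = 1 * x * 1 := by ring
      _ ≤ Real.sqrt 2 * x * (S + 4) := by gcongr; linarith
      _ = ε := hεx.symm
  have hPq : P ≤ q := by
    have := (div_lt_one hq0).1 hx1
    exact this.le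
  -- A bound below 1 forces P ≤ d^(1/4). So log(d/P) is positive and at least (3/4) log d, and the
  -- square root is not a default value.
  have hlogP : Real.log P ≤ l / 4 := by
    have h3 := Real.log_le_log hP0 hPq
    rw [hq, Real.log_rpow hd0] at h3
    linarith
  have hSl : 3 / 4 * l ≤ S ^ 2 := by
    have h4 : Real.log (d / P) = l - Real.log P := Real.log_div hd0.ne' hP0.ne'
    rw [hS, Real.sq_sqrt (by rw [h4]; linarith), h4]
    linarith
  have hεlow : 3 / 2 * (l * x ^ 2) + 32 * x ^ 2 ≤ ε ^ 2 := by
    have h5 : 3 / 4 * l + 16 ≤ (S + 4) ^ 2 := by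
      have : (S + 4) ^ 2 = S ^ 2 + 8 * S + 16 := by ring
      linarith
    calc 3 / 2 * (l * x ^ 2) + 32 * x ^ 2 = 2 * x ^ 2 * (3 / 4 * l + 16) := by ring
      _ ≤ 2 * x ^ 2 * (S + 4) ^ 2 := by gcongr
      _ = ε ^ 2 := hε2.symm
  have hlx : l * x ^ 2 ≤ 1 := by
    have : 0 ≤ x ^ 2 := sq_nonneg x
    linarith
  -- the second moment term
  have hP2 : P ^ 2 = 320 ^ T * (5 * lam ^ 2) ^ T := by
    rw [hP, ← pow_mul, mul_comm T 2, pow_mul, ← mul_pow]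
    congr 1
    ring
  -- Since 320 = 16 · 20, one factor absorbs the 16 of `overlapLevel` and leaves 1/20 to spare; this
  -- needs T ≥ 1.
  have h320 : (320 : ℝ) ≤ 320 ^ T := le_self_pow₀ (by norm_num) hT
  have hκeq : d * lam ^ 2 * overlapLevel d lam l T = 16 * l * (5 * lam ^ 2) ^ T := by
    rw [overlapLevel]
    field_simp
  have hx2 : x ^ 2 * Real.sqrt d = P ^ 2 := by
    rw [hx, div_pow, hq2, div_mul_cancel₀ _ hs0.ne']
  have hκle : d * lam ^ 2 * overlapLevel d lam l T ≤ (l * x ^ 2) / 20 * Real.sqrt d := by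
    have h5 : (l * x ^ 2) / 20 * Real.sqrt d = l / 20 * (320 ^ T * (5 * lam ^ 2) ^ T) := by
      rw [← hP2, ← hx2]; ring
    rw [hκeq, h5]
    have h6 : 0 ≤ l * (5 * lam ^ 2) ^ T := by positivity
    calc 16 * l * (5 * lam ^ 2) ^ T = 320 * (l * (5 * lam ^ 2) ^ T) / 20 := by ring
      _ ≤ 320 ^ T * (l * (5 * lam ^ 2) ^ T) / 20 := by gcongr
      _ = _ := by ring
  -- the truncated mass
  have hTx : 2 * (T * (Real.sqrt 2 * Real.exp (-l))) ≤ 32 * x ^ 2 := by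
    have h7 : Real.exp (-l) = (d : ℝ)⁻¹ := by rw [Real.exp_neg, hl, Real.exp_log hd0]
    have h8 : (T : ℝ) ≤ P := by
      have h9 : (T : ℝ) ≤ 2 ^ T := by exact_mod_cast Nat.lt_two_pow_self.le
      refine h9.trans (pow_le_pow_left₀ (by norm_num) (by linarith) T)
    have h10 : Real.sqrt 2 ≤ 2 := Real.sqrt_le_iff.2 ⟨by norm_num, by norm_num⟩
    have h11 : x ^ 2 = P ^ 2 / Real.sqrt d := by rw [← hx2, mul_div_cancel_right₀ _ hs0.ne']
    rw [h7, h11]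
    calc 2 * ((T : ℝ) * (Real.sqrt 2 * (d : ℝ)⁻¹)) ≤ 2 * (P * (2 * (Real.sqrt d)⁻¹)) := by gcongr
      _ = 4 * P / Real.sqrt d := by ring
      _ ≤ 32 * P ^ 2 / Real.sqrt d := by
        gcongr ?_ / _
        nlinarith
      _ = _ := by ring
  refine ⟨hεpos, hκle.trans ?_, ?_⟩
  · exact mul_le_of_le_one_left hs0.le (by linarith)
  · have h12 : d * lam ^ 2 * overlapLevel d lam l T / Real.sqrt d ≤ (l * x ^ 2) / 20 :=
      (div_le_iff₀ hs0).2 hκle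
    have h13 : 0 ≤ l * x ^ 2 := by positivity
    linarith

end Numerics

end SpikedQuery

end

/-! ### The theorem -/

theorem mainTheorem10 :
    ∃ c₁ : ℝ, 1 < c₁ ∧
      ∀ (d T : ℕ) (_hd : 0 < d) (Ξ : Type*) [MeasurableSpace Ξ]
        (A : SpikedQuery.QueryAlgorithm d T Ξ)
        (ρ : MeasureTheory.Measure Ξ) [MeasureTheory.IsProbabilityMeasure ρ]
        (lam : ℝ) (_hlam : 2 < lam),
        SpikedQuery.tvDist (SpikedQuery.transcriptLaw A ρ lam 0) (SpikedQuery.mixtureLaw A ρ lam) ≤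
          Real.sqrt 2 * (c₁ * lam) ^ T / (d : ℝ) ^ (1 / 4 : ℝ) *
            (Real.sqrt (Real.log ((d : ℝ) / (c₁ * lam) ^ T)) + 4) := by
  -- The constant 40 comes from 40² = 320 · 5, with 5λ² the growth of the overlap level per round.
  refine ⟨40, by norm_num, ?_⟩
  intro d T hd Ξ _ A ρ _ lam hlam
  have := SpikedQuery.isProbabilityMeasure_mixtureLaw hd A ρ lam
  have hpos : 0 ≤ Real.sqrt 2 * (40 * lam) ^ T / (d : ℝ) ^ (1 / 4 : ℝ) *
      (Real.sqrt (Real.log ((d : ℝ) / (40 * lam) ^ T)) + 4) := by positivity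
  -- Without queries there is only one transcript, so the distance vanishes.
  rcases eq_or_ne T 0 with rfl | hT
  · exact (SpikedQuery.tvDist_of_subsingleton _ _).trans hpos
  rcases le_or_gt 1 (Real.sqrt 2 * (40 * lam) ^ T / (d : ℝ) ^ (1 / 4 : ℝ) *
      (Real.sqrt (Real.log ((d : ℝ) / (40 * lam) ^ T)) + 4)) with h1 | h1
  · exact (SpikedQuery.tvDist_le_one _ _).trans h1
  obtain ⟨hε, hκ, hpε⟩ := SpikedQuery.numeric_bound hd hT hlam rfl h1
  refine SpikedQuery.tvDist_le_of_forall_le _ _ hpos fun B hB => ?_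
  exact SpikedQuery.transcriptLaw_zero_le hd A ρ hlam
    (Real.log_nonneg (by exact_mod_cast hd)) hε hκ hpε hB
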